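/- Let $\mathbb D\subset\mathbb C$ be the open unit disk and let $\varphi\colon\partial\mathbb D\to\partial\mathbb D$ be a homeomorphism of the unit circle onto itself. Let $\Phi\colon[0,\infty)\to[0,\infty)$ be an $N$-function, that is, $\Phi$ is continuous, convex and increasing, $\Phi(0)=0$, $\lim_{t\to0^+}\Phi(t)/t=0$ and $\lim_{t\to\infty}\Phi(t)/t=\infty$. Suppose that $\Phi$ is doubling, i.e. there is a constant $C_D\ge2$ with $\Phi(2t)\le C_D\,\Phi(t)$ for all $t\ge0$, and that, for some $p>1$ and $t_0\ge0$, $\Phi$ satisfies $(\mathrm{aInc})_p$ for $t\ge t_0$, i.e. there is a constant $C_A\ge1$ with $$\frac{\Phi(s)}{s^p}\le C_A\,\frac{\Phi(t)}{t^p}\qquad\text{whenever } t_0\le s\le t,\ s>0.$$ Then $\varphi$ satisfies the $\Phi$-Douglas condition $$\int_{\partial\mathbb D}\int_{\partial\mathbb D}\Phi\!\left(\left|\frac{\varphi(\xi)-\varphi(\eta)}{\xi-\eta}\right|\right)|d\xi|\,|d\eta|<\infty$$ if and only if there is a homeomorphism $h\colon\overline{\mathbb D}\to\overline{\mathbb D}$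 of the closed disk onto itself with $h=\varphi$ on $\partial\mathbb D$ and $h\in W^{1,\Phi}(\mathbb D,\mathbb C)$, where $$W^{1,\Phi}(\mathbb D,\mathbb C)=\Big\{f\in W^{1,1}(\mathbb D,\mathbb C):\int_{\mathbb D}\Phi(|Df(x)|)\,dx<\infty\Big\}$$ and $|Df|$ is the operator norm of the weak differential. -/

import Mathlib

open MeasureTheory Set Filter Topology
open scoped ENNReal

noncomputable section

namespace OrliczExtension

/-- `Φ : [0,∞) → [0,∞)` is an `N`-function. Only the values of `Φ` on `[0,∞)` matter. -/
structure IsNFunction (Φ : ℝ → ℝ) : Prop where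
  nonneg : ∀ t, 0 ≤ t → 0 ≤ Φ t
  continuousOn : ContinuousOn Φ (Ici 0)
  convexOn : ConvexOn ℝ (Ici 0) Φ
  monotoneOn : MonotoneOn Φ (Ici 0)
  map_zero : Φ 0 = 0
  tendsto_zero : Tendsto (fun t => Φ t / t) (𝓝[>] 0) (𝓝 0)
  tendsto_atTop : Tendsto (fun t => Φ t / t) atTop atTop

/-- The doubling (`Δ₂`) condition. -/
def IsDoubling (Φ : ℝ → ℝ) : Prop :=
  ∃ C : ℝ, 2 ≤ C ∧ ∀ t, 0 ≤ t → Φ (2 * t) ≤ C * Φ t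

/-- The condition `(aInc)_p` for `t ≥ t₀`: the function `Φ(t) / t ^ p` is almost increasing on
the positive numbers of `[t₀, ∞)`. -/
def AIncFrom (Φ : ℝ → ℝ) (p t₀ : ℝ) : Prop :=
  ∃ C : ℝ, 1 ≤ C ∧ ∀ s t, 0 < s → t₀ ≤ s → s ≤ t → Φ s / s ^ p ≤ C * (Φ t / t ^ p)

/-- The unit circle `∂𝔻`. -/
abbrev UnitCircle : Type := Metric.sphere (0 : ℂ) 1

/-- The closed unit disk. -/
abbrev ClosedDisk : Type := Metric.closedBall (0 : ℂ) 1

/-- The open unit disk `𝔻`. -/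
def openDisk : TopologicalSpace.Opens ℂ := ⟨Metric.ball (0 : ℂ) 1, Metric.isOpen_ball⟩

/-- The arc-length parametrization `θ ↦ exp (i θ)` of the unit circle. -/
def circlePoint (θ : ℝ) : UnitCircle :=
  ⟨circleMap 0 1 θ, circleMap_mem_sphere 0 zero_le_one θ⟩

/-- Arc length `|dξ|` on the unit circle (of total mass `2π`). -/
def arcLength : Measure UnitCircle :=
  (volume.restrict (Ioc (0 : ℝ) (2 * Real.pi))).map circlePoint

/-- The `Φ`-Douglas condition for a map `φ` from the unit circle to `ℂ`. The integrand is
nonnegative, so finiteness is that of the `[0,∞]`-valued integral; the diagonal `ξ = η` is a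
null set. -/
def DouglasCondition (Φ : ℝ → ℝ) (φ : UnitCircle → ℂ) : Prop :=
  ∫⁻ ξ, ∫⁻ η, ENNReal.ofReal (Φ ‖(φ ξ - φ η) / ((ξ : ℂ) - (η : ℂ))‖) ∂arcLength ∂arcLength < ∞

/-- `g` is the weak (real) differential of `f` in the open set `Ω ⊆ ℂ = ℝ²`: both are locally
integrable, and `∫_Ω (∂_v η) f = - ∫_Ω η (g v)` for every smooth compactly supported test
function `η` in `Ω` and every direction `v`. -/
structure HasWeakDifferential (Ω : TopologicalSpace.Opens ℂ) (f : ℂ → ℂ)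
    (g : ℂ → (ℂ →L[ℝ] ℂ)) : Prop where
  locallyIntegrableOn : LocallyIntegrableOn f Ω
  locallyIntegrableOn_differential : LocallyIntegrableOn g Ω
  integral_eq : ∀ (η : TestFunction Ω ℝ (⊤ : ℕ∞)) (v : ℂ),
    ∫ x in (Ω : Set ℂ), (fderiv ℝ η x v) • f x = - ∫ x in (Ω : Set ℂ), (η x) • (g x v)

/-- The Orlicz-Sobolev class `W^{1,Φ}(Ω, ℂ)`: the function is in `W^{1,1}(Ω, ℂ)`, i.e. it is
integrable with an integrable weak differential `Df`, and `∫_Ω Φ(|Df|) < ∞`. -/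
def MemOrliczSobolev (Φ : ℝ → ℝ) (Ω : TopologicalSpace.Opens ℂ) (f : ℂ → ℂ) : Prop :=
  IntegrableOn f Ω ∧ ∃ Df : ℂ → (ℂ →L[ℝ] ℂ), HasWeakDifferential Ω f Df ∧
    IntegrableOn Df Ω ∧ ∫⁻ x in (Ω : Set ℂ), ENNReal.ofReal (Φ ‖Df x‖) < ∞

/-- The restriction of `h : ℂ → ℂ` to the closed unit disk is a homeomorphism of the closed disk
onto itself, and it agrees with `φ` on the unit circle. -/
def IsHomeomorphicExtension (φ : UnitCircle ≃ₜ UnitCircle) (h : ℂ → ℂ) : Prop :=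
  (∃ H : ClosedDisk ≃ₜ ClosedDisk, ∀ z : ClosedDisk, h z = H z) ∧
    ∀ ξ : UnitCircle, h ξ = φ ξ

end OrliczExtension

end

/-!
# Orlicz-Sobolev homeomorphic extensions of circle homeomorphisms

Only the continuity of the extension on the closed disk matters for the necessity of the Douglas
condition, and only the monotonicity of a lift of the circle map for its sufficiency. Both directions
use the coordinate `expI (x + i y) = exp (i (x + i y))`, in which the circle is the line `y = 0`. Since
`Φ` is used on `[0, ∞)` only, it may be replaced by the continuous function `t ↦ Φ |t|`.

**The trace inequality.** For a smooth map `f`, join `x` and `x + τ` by a vertical segment of length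
`|τ|`, a horizontal one and again a vertical one. The difference quotient of `f` on the circle is at most
a constant times the sum of the means of `|Df|` over these segments
(`norm_divided_difference_le`). Jensen's inequality handles the horizontal mean, and a Hardy inequality
for `Φ` handles the vertical ones (`exists_hardy`); here `p > 1` in `AIncFrom` is needed. The threshold
`t₀` costs an additive constant, which is harmless on a domain of finite measure. The outcome is
`exists_trace_inequality`. A map that is continuous on the closed disk and has a weak differential is
approximated by dilated mollifications, whose `Φ`-energy is controlled by Jensen's inequality, and
Fatou's lemma gives the Douglas condition (`MemOrliczSobolev.douglasCondition`).

**The extension.** Up to a reflection, the circle homeomorphism lifts to an increasing map `ψ` of the line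
that commutes with the translation by `2π` (`exists_strictMono_lift`). Its Beurling-Ahlfors extension
is built from the means of `ψ` over `[x, x + y]` and `[x - y, x]`. Strict monotonicity of these means
makes it injective, and the intermediate value theorem makes it surjective, on the closed half plane;
so it descends to a homeomorphism `diskExtension` of the closed disk. Its differential at `x + i y`
is bounded by a multiple of `(ψ (x + y) - ψ (x - y)) / y`, a difference quotient of `ψ`, and the change
of variables `(x, y) ↦ (x - y, 2 y)` turns the `Φ`-energy near the circle into the Douglas integral
(`IsCircleLift.lintegral_fderiv_lt_top`). At the origin the extension is only continuous, which the
divergence theorem allows (`hasWeakDifferential_fderiv`).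
-/

open MeasureTheory Set Filter Topology
open scoped ENNReal

noncomputable section

namespace OrliczExtension

/-! ### Integration over the circle and the disk -/

/-- The conformal coordinate `z ↦ exp (i z)`: it maps the upper half plane onto the punctured unit
disk, the real line onto the circle, and has period `2π`. -/
def expI (z : ℂ) : ℂ := Complex.exp (Complex.I * z)

theorem continuous_expI : Continuous expI := by unfold expI; fun_prop

theorem norm_expI (z : ℂ) : ‖expI z‖ = Real.exp (-z.im) := by
  simp [expI, Complex.norm_exp]

theorem expI_add (z w : ℂ) : expI (z + w) = expI z * expI w := by
  simp [expI, mul_add, Complex.exp_add]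

theorem expI_add_two_pi (z : ℂ) : expI (z + (2 * Real.pi : ℝ)) = expI z := by
  rw [expI_add]
  have : expI ((2 * Real.pi : ℝ) : ℂ) = 1 := by
    rw [expI, ← Complex.exp_two_pi_mul_I]; congr 1; push_cast; ring
  rw [this, mul_one]

theorem coe_circlePoint (θ : ℝ) : (circlePoint θ : ℂ) = expI θ := by
  simp [circlePoint, circleMap, expI, mul_comm]

theorem continuous_circlePoint : Continuous circlePoint :=
  Continuous.subtype_mk (continuous_circleMap 0 1) _

theorem circlePoint_add_two_pi (θ : ℝ) : circlePoint (θ + 2 * Real.pi) = circlePoint θ := by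
  apply Subtype.ext
  rw [coe_circlePoint, coe_circlePoint, Complex.ofReal_add, expI_add_two_pi]

theorem lintegral_Ioc_eq_of_periodic {g : ℝ → ℝ≥0∞} {T : ℝ} (hT : 0 < T)
    (hg : Function.Periodic g T) (a b : ℝ) :
    ∫⁻ x in Ioc a (a + T), g x = ∫⁻ x in Ioc b (b + T), g x :=
  (isAddFundamentalDomain_Ioc hT a).setLIntegral_eq (isAddFundamentalDomain_Ioc hT b) g
    hg.map_vadd_zmultiples

theorem lintegral_Ioc_add_right {g : ℝ → ℝ≥0∞} (a b c : ℝ) :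
    ∫⁻ x in Ioc a b, g (x + c) = ∫⁻ x in Ioc (a + c) (b + c), g x := by
  have h := (measurePreserving_add_right (volume : Measure ℝ) c).setLIntegral_comp_preimage_emb
    (MeasurableEquiv.addRight c).measurableEmbedding g (Ioc (a + c) (b + c))
  simpa using h

theorem lintegral_period_add_right {g : ℝ → ℝ≥0∞} (hg : Function.Periodic g (2 * Real.pi))
    (c : ℝ) :
    ∫⁻ x in Ioc 0 (2 * Real.pi), g (x + c) = ∫⁻ x in Ioc 0 (2 * Real.pi), g x := by
  rw [lintegral_Ioc_add_right]
  have := lintegral_Ioc_eq_of_periodic Real.two_pi_pos hg (0 + c) 0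
  rw [zero_add] at this ⊢
  rw [add_comm (2 * Real.pi) c, this, zero_add]

/-- Double integrals over the circle in terms of a base point and a signed angle. -/
theorem lintegral_arcLength_arcLength {K : UnitCircle → UnitCircle → ℝ≥0∞}
    (hK : Measurable (Function.uncurry K)) :
    ∫⁻ ξ, ∫⁻ η, K ξ η ∂arcLength ∂arcLength =
      ∫⁻ s in Ioc 0 (2 * Real.pi), ∫⁻ τ in Ioc (-Real.pi) Real.pi,
        K (circlePoint s) (circlePoint (s + τ)) := by
  have hc := continuous_circlePoint.measurable
  have h1 : ∀ ξ, ∫⁻ η, K ξ η ∂arcLength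
      = ∫⁻ t in Ioc 0 (2 * Real.pi), K ξ (circlePoint t) := fun ξ => by
    rw [arcLength, lintegral_map (f := K ξ) (hK.comp measurable_prodMk_left) hc]
  simp_rw [h1]
  rw [arcLength, lintegral_map _ hc]
  · refine lintegral_congr fun s => ?_
    have hper : Function.Periodic (fun t => K (circlePoint s) (circlePoint t)) (2 * Real.pi) :=
      fun t => by simp only [circlePoint_add_two_pi]
    have h2 := lintegral_Ioc_add_right (g := fun t => K (circlePoint s) (circlePoint t))
      (-Real.pi) Real.pi s
    simp_rw [add_comm _ s] at h2
    rw [h2]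
    have := lintegral_Ioc_eq_of_periodic Real.two_pi_pos hper 0 (s + -Real.pi)
    rw [zero_add] at this
    rw [this]
    congr 2
    congr 1
    ring
  · exact Measurable.lintegral_prod_right'
      (f := fun q : UnitCircle × ℝ => K q.1 (circlePoint q.2))
      (hK.comp (measurable_fst.prodMk (hc.comp measurable_snd)))

/-- Integration over the unit disk in the conformal coordinate `exp (i (x + i y))`. -/
theorem lintegral_openDisk {g : ℂ → ℝ≥0∞} (hg : Measurable g) :
    ∫⁻ w in Metric.ball (0 : ℂ) 1, g w =
      ∫⁻ y in Ioi (0 : ℝ), ENNReal.ofReal (Real.exp (-(2 * y))) *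
        ∫⁻ x in Ioc 0 (2 * Real.pi), g (expI (x + y * Complex.I)) := by
  have hpol : ∀ p : ℝ × ℝ, Complex.polarCoord.symm p = p.1 * expI p.2 := fun p => by
    rw [Complex.polarCoord_symm_apply, expI, mul_comm Complex.I, Complex.exp_mul_I]
    simp
  rw [← lintegral_indicator Metric.isOpen_ball.measurableSet,
    ← Complex.lintegral_comp_polarCoord_symm]
  simp_rw [hpol]
  rw [polarCoord_target, Measure.volume_eq_prod, ← Measure.prod_restrict, lintegral_prod]
  swap
  · apply Measurable.aemeasurable
    refine (ENNReal.measurable_ofReal.comp measurable_fst).smul ?_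
    refine (hg.indicator Metric.isOpen_ball.measurableSet).comp ?_
    refine (Complex.measurable_ofReal.comp measurable_fst).mul ?_
    exact continuous_expI.measurable.comp (Complex.measurable_ofReal.comp measurable_snd)
  have h1 : ∀ r : ℝ, r ∈ Ioi (0 : ℝ) → ∫⁻ θ in Ioo (-Real.pi) Real.pi, ENNReal.ofReal r •
      (Metric.ball (0 : ℂ) 1).indicator g (r * expI θ) =
      (Ioo (0 : ℝ) 1).indicator (fun r => ENNReal.ofReal r *
        ∫⁻ x in Ioc 0 (2 * Real.pi), g (r * expI x)) r := by
    intro r hr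
    have hn : ∀ θ : ℝ, ‖(r : ℂ) * expI θ‖ = r := fun θ => by
      rw [norm_mul, norm_expI]; simp [abs_of_pos (mem_Ioi.1 hr)]
    by_cases h : r < 1
    · have hm : ∀ θ : ℝ, (r : ℂ) * expI θ ∈ Metric.ball (0 : ℂ) 1 := fun θ => by
        rw [mem_ball_zero_iff, hn]; exact h
      simp only [indicator_of_mem (hm _), indicator_of_mem (show r ∈ Ioo (0 : ℝ) 1 from ⟨hr, h⟩),
        smul_eq_mul]
      rw [lintegral_const_mul]
      · congr 1
        have hper : Function.Periodic (fun x : ℝ => g (r * expI x)) (2 * Real.pi) := fun x => by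
          simp only [Complex.ofReal_add, expI_add_two_pi]
        have := lintegral_Ioc_eq_of_periodic Real.two_pi_pos hper 0 (-Real.pi)
        rw [zero_add] at this
        rw [this, setLIntegral_congr Ioo_ae_eq_Ioc]
        congr 3
        ring
      · exact hg.comp (measurable_const.mul
          (continuous_expI.measurable.comp Complex.measurable_ofReal))
    · have hm : ∀ θ : ℝ, (r : ℂ) * expI θ ∉ Metric.ball (0 : ℂ) 1 := fun θ => by
        rw [mem_ball_zero_iff, hn]; exact h
      simp only [indicator_of_notMem (hm _),
        indicator_of_notMem (show r ∉ Ioo (0 : ℝ) 1 from fun h' => h h'.2), smul_zero,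
        lintegral_zero]
  rw [setLIntegral_congr_fun measurableSet_Ioi h1, lintegral_indicator measurableSet_Ioo,
    Measure.restrict_restrict measurableSet_Ioo,
    inter_eq_left.2 (Ioo_subset_Ioi_self : Ioo (0 : ℝ) 1 ⊆ Ioi 0)]
  have himg : (fun y : ℝ => Real.exp (-y)) '' Ioi 0 = Ioo 0 1 := by
    ext r
    constructor
    · rintro ⟨y, hy, rfl⟩
      exact ⟨Real.exp_pos _, by simpa using hy⟩
    · intro hr
      refine ⟨-Real.log r, by simpa using Real.log_neg hr.1 hr.2, by simp [Real.exp_log hr.1]⟩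
  rw [← himg, lintegral_image_eq_lintegral_abs_deriv_mul measurableSet_Ioi
    (f' := fun y => -Real.exp (-y))
    (fun y _ => by simpa using ((hasDerivAt_neg y).exp).hasDerivWithinAt)
    (fun a _ b _ hab => by simpa using hab)]
  refine setLIntegral_congr_fun measurableSet_Ioi fun y _ => ?_
  simp only [abs_neg, abs_of_pos (Real.exp_pos _)]
  rw [← mul_assoc, ← ENNReal.ofReal_mul (Real.exp_pos _).le, ← Real.exp_add]
  congr 2
  · ring_nf
  · funext x
    rw [expI_add]
    congr 1
    rw [mul_comm]
    congr 1
    rw [expI, Complex.ofReal_exp]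
    congr 1
    push_cast
    linear_combination (-(y : ℂ)) * Complex.I_mul_I

/-! ### Jensen's inequality and Young functions -/

/-- Jensen's inequality for the `[0, ∞]`-valued integral; `Φ ∘ u` need not be integrable. -/
theorem ofReal_map_integral_le_lintegral {α : Type*} [MeasurableSpace α] {μ : Measure α}
    [IsProbabilityMeasure μ] {Φ : ℝ → ℝ} (hN : IsNFunction Φ) (hc : Continuous Φ) {u : α → ℝ}
    (hu : Integrable u μ) (hu0 : ∀ a, 0 ≤ u a) :
    ENNReal.ofReal (Φ (∫ a, u a ∂μ)) ≤ ∫⁻ a, ENNReal.ofReal (Φ (u a)) ∂μ := by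
  by_cases h : ∫⁻ a, ENNReal.ofReal (Φ (u a)) ∂μ = ∞
  · rw [h]; exact le_top
  have hnn : ∀ a, 0 ≤ Φ (u a) := fun a => hN.nonneg _ (hu0 a)
  have hm : AEStronglyMeasurable (fun a => Φ (u a)) μ :=
    hc.comp_aestronglyMeasurable hu.aestronglyMeasurable
  have hi : Integrable (fun a => Φ (u a)) μ := by
    refine ⟨hm, ?_⟩
    rw [hasFiniteIntegral_iff_ofReal (Eventually.of_forall hnn)]
    exact lt_top_iff_ne_top.2 h
  rw [← ofReal_integral_eq_lintegral_ofReal hi (Eventually.of_forall hnn)]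
  exact ENNReal.ofReal_le_ofReal (hN.convexOn.map_integral_le hN.continuousOn isClosed_Ici
    (Eventually.of_forall hu0) hu hi)

theorem IsNFunction.map_add_add_le {Φ : ℝ → ℝ} (hN : IsNFunction Φ) {a b c : ℝ} (ha : 0 ≤ a)
    (hb : 0 ≤ b) (hc : 0 ≤ c) : Φ (a + b + c) ≤ Φ (3 * a) + Φ (3 * b) + Φ (3 * c) := by
  have h1 := hN.nonneg (3 * a) (by positivity)
  have h2 := hN.nonneg (3 * b) (by positivity)
  have h3 := hN.nonneg (3 * c) (by positivity)
  have key : ∀ m : ℝ, a + b + c ≤ 3 * m → Φ (a + b + c) ≤ Φ (3 * m) := fun m hm =>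
    hN.monotoneOn (mem_Ici.2 (by positivity)) (mem_Ici.2 (by linarith)) hm
  rcases le_total a b with hab | hab
  · rcases le_total b c with hbc | hbc
    · linarith [key c (by linarith)]
    · linarith [key b (by linarith)]
  · rcases le_total a c with hac | hac
    · linarith [key c (by linarith)]
    · linarith [key a (by linarith)]

theorem IsDoubling.exists_map_two_pow_mul_le {Φ : ℝ → ℝ} (hD : IsDoubling Φ) (n : ℕ) :
    ∃ C : ℝ, 0 ≤ C ∧ ∀ t, 0 ≤ t → Φ (2 ^ n * t) ≤ C * Φ t := by
  obtain ⟨C, hC, h⟩ := hD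
  refine ⟨C ^ n, by positivity, ?_⟩
  induction n with
  | zero => intro t _; simp
  | succ n ih =>
    intro t ht
    calc Φ (2 ^ (n + 1) * t) = Φ (2 * (2 ^ n * t)) := by congr 1; ring
      _ ≤ C * Φ (2 ^ n * t) := h _ (by positivity)
      _ ≤ C * (C ^ n * Φ t) := mul_le_mul_of_nonneg_left (ih t ht) (by linarith)
      _ = C ^ (n + 1) * Φ t := by ring

theorem IsDoubling.exists_map_mul_le {Φ : ℝ → ℝ} (hN : IsNFunction Φ) (hD : IsDoubling Φ)
    {a : ℝ} (ha : 0 ≤ a) : ∃ C : ℝ, 0 ≤ C ∧ ∀ t, 0 ≤ t → Φ (a * t) ≤ C * Φ t := by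
  obtain ⟨n, hn⟩ := pow_unbounded_of_one_lt a one_lt_two
  obtain ⟨C, hC, h⟩ := hD.exists_map_two_pow_mul_le n
  refine ⟨C, hC, fun t ht => (hN.monotoneOn (mem_Ici.2 (by positivity))
    (mem_Ici.2 (by positivity)) ?_).trans (h t ht)⟩
  exact mul_le_mul_of_nonneg_right hn.le ht

/-- The threshold in `AIncFrom` costs only an additive constant. -/
theorem AIncFrom.exists_map_mul_le {Φ : ℝ → ℝ} {p t₀ : ℝ} (hN : IsNFunction Φ) (ht₀ : 0 ≤ t₀)
    (hA : AIncFrom Φ p t₀) :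
    ∃ C : ℝ, 0 ≤ C ∧ ∀ μ t, 0 < μ → μ ≤ 1 → 0 ≤ t → Φ (μ * t) ≤ C * μ ^ p * Φ t + Φ t₀ := by
  obtain ⟨C, hC, h⟩ := hA
  refine ⟨C, by linarith, fun μ t hμ hμ1 ht => ?_⟩
  have h0 := hN.nonneg t₀ ht₀
  have h1 : 0 ≤ C * μ ^ p * Φ t := by have := hN.nonneg t ht; positivity
  rcases le_total (μ * t) t₀ with hle | hle
  · have := hN.monotoneOn (mem_Ici.2 (by positivity)) (mem_Ici.2 ht₀) hle
    linarith
  rcases ht.eq_or_lt with rfl | htpos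
  · simp only [mul_zero, hN.map_zero] at *; linarith
  have := h (μ * t) t (by positivity) hle (by nlinarith)
  rw [div_le_iff₀ (by positivity), Real.mul_rpow hμ.le ht] at this
  have h2 : C * (Φ t / t ^ p) * (μ ^ p * t ^ p) = C * μ ^ p * Φ t := by
    have : t ^ p ≠ 0 := (by positivity : 0 < t ^ p).ne'
    field_simp
  linarith

/-! ### A Hardy inequality and the trace inequality for smooth maps -/

theorem lintegral_Ioc_mul_right {g : ℝ → ℝ≥0∞} {c : ℝ} (hc : 0 < c) (R : ℝ) :
    ∫⁻ x in Ioc 0 R, g (x * c) = ENNReal.ofReal c⁻¹ * ∫⁻ x in Ioc 0 (R * c), g x := by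
  have he : MeasurableEmbedding (fun x : ℝ => x * c) :=
    (Homeomorph.mulRight₀ c hc.ne').measurableEmbedding
  have h1 : ∀ x, (Ioc 0 R).indicator (fun x => g (x * c)) x =
      (Ioc 0 (R * c)).indicator g (x * c) := fun x => by
    have : x ∈ Ioc 0 R ↔ x * c ∈ Ioc 0 (R * c) := by
      simp only [mem_Ioc, mul_pos_iff_of_pos_right hc, mul_le_mul_iff_left₀ hc]
    by_cases hx : x ∈ Ioc 0 R
    · rw [indicator_of_mem hx, indicator_of_mem (this.1 hx)]
    · rw [indicator_of_notMem hx, indicator_of_notMem (fun h => hx (this.2 h))]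
  rw [← lintegral_indicator measurableSet_Ioc, ← lintegral_indicator measurableSet_Ioc]
  simp_rw [h1]
  rw [← he.lintegral_map (fun y => (Ioc 0 (R * c)).indicator g y),
    Real.map_volume_mul_right hc.ne', lintegral_smul_measure,
    abs_of_pos (inv_pos.2 hc), smul_eq_mul]

theorem lintegral_comp_abs_le {g : ℝ → ℝ≥0∞} (R : ℝ) :
    ∫⁻ τ in Ioc (-R) R, g |τ| ≤ 2 * ∫⁻ τ in Ioc 0 R, g τ := by
  have hsub : Ioc (-R) R ⊆ Ioc (-R) 0 ∪ Ioc 0 R := fun x hx => by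
    rcases le_or_gt x 0 with h | h
    · exact Or.inl ⟨hx.1, h⟩
    · exact Or.inr ⟨h, hx.2⟩
  refine (lintegral_mono_set hsub).trans ((lintegral_union_le _ _ _).trans ?_)
  rw [two_mul]
  refine add_le_add (le_of_eq ?_) (le_of_eq ?_)
  · have h := (Measure.measurePreserving_neg (volume : Measure ℝ)).setLIntegral_comp_preimage_emb
      (MeasurableEquiv.neg ℝ).measurableEmbedding g (Ico 0 R)
    rw [← restrict_Ico_eq_restrict_Ioc (a := 0), ← h]
    simp only [neg_preimage, neg_Ico, neg_zero]
    refine setLIntegral_congr_fun measurableSet_Ioc fun x hx => ?_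
    simp only [abs_of_nonpos hx.2]
  · refine setLIntegral_congr_fun measurableSet_Ioc fun x hx => ?_
    simp only [abs_of_pos hx.1]

/-- Hardy's inequality for `Φ`. The substitution `l = μ ^ 2` turns the mean of `u` over `[0, T]` into
the mean of `2 μ u (T μ ^ 2)` over `μ ∈ [0, 1]`; Jensen's inequality and the gain `μ ^ p` from
`AIncFrom` leave the integral of `μ ^ (p - 2)`, which is finite because `p > 1`. -/
theorem exists_hardy {Φ : ℝ → ℝ} {p t₀ : ℝ} (hp : 1 < p) (ht₀ : 0 ≤ t₀) (hN : IsNFunction Φ)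
    (hc : Continuous Φ) (hA : AIncFrom Φ p t₀) :
    ∃ C : ℝ≥0∞, C ≠ ∞ ∧ ∀ R : ℝ, ∀ u : ℝ → ℝ, Continuous u → (∀ x, 0 ≤ u x) →
      ∫⁻ T in Ioc 0 R, ENNReal.ofReal (Φ (∫ l in (0 : ℝ)..1, u (T * l))) ≤
        C * (∫⁻ t in Ioc 0 R, ENNReal.ofReal (Φ (2 * u t))) +
          ENNReal.ofReal (Φ t₀) * ENNReal.ofReal R := by
  obtain ⟨C, hC, hCA⟩ := hA.exists_map_mul_le hN ht₀
  refine ⟨∫⁻ μ in Ioc (0 : ℝ) 1, ENNReal.ofReal (C * μ ^ (p - 2)), ?_, fun R u hu hu0 => ?_⟩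
  · have hint : IntegrableOn (fun μ : ℝ => C * μ ^ (p - 2)) (Ioc 0 1) :=
      (intervalIntegrable_iff_integrableOn_Ioc_of_le zero_le_one).1
        ((intervalIntegral.intervalIntegrable_rpow' (by linarith)).const_mul C)
    have := hint.2
    rw [hasFiniteIntegral_iff_ofReal] at this
    · exact this.ne
    · refine (ae_restrict_iff' measurableSet_Ioc).2 (Eventually.of_forall fun μ hμ => ?_)
      have := hμ.1
      simp only [Pi.zero_apply]
      positivity
  have : IsProbabilityMeasure (volume.restrict (Ioc (0 : ℝ) 1)) := ⟨by simp⟩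
  set N : ℝ → ℝ≥0∞ := fun t => ENNReal.ofReal (Φ (2 * u t))
  have hNm : Measurable N :=
    (ENNReal.continuous_ofReal.comp (hc.comp (continuous_const.mul hu))).measurable
  have h1 : ∀ T : ℝ, ENNReal.ofReal (Φ (∫ l in (0 : ℝ)..1, u (T * l))) ≤
      ∫⁻ μ in Ioc (0 : ℝ) 1,
        (ENNReal.ofReal (C * μ ^ p) * N (T * μ ^ 2) + ENNReal.ofReal (Φ t₀)) := by
    intro T
    have hsub : ∫ l in (0 : ℝ)..1, u (T * l) =
        ∫ μ in Ioc (0 : ℝ) 1, u (T * μ ^ 2) * (2 * |μ|) := by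
      have := intervalIntegral.integral_comp_mul_deriv (a := 0) (b := 1) (f := fun μ : ℝ => μ ^ 2)
        (f' := fun μ => 2 * μ) (g := fun l => u (T * l))
        (fun x _ => by simpa using hasDerivAt_pow 2 x) (by fun_prop) (by fun_prop)
      simp only [Function.comp_apply, one_pow, ne_eq, OfNat.ofNat_ne_zero, not_false_eq_true,
        zero_pow] at this
      rw [← this, intervalIntegral.integral_of_le zero_le_one]
      exact setIntegral_congr_fun measurableSet_Ioc fun x hx => by simp only [abs_of_pos hx.1]
    rw [hsub]
    refine (ofReal_map_integral_le_lintegral hN hc (Continuous.integrableOn_Ioc (by fun_prop))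
      (fun μ => mul_nonneg (hu0 _) (by positivity))).trans
      (setLIntegral_mono' measurableSet_Ioc fun μ hμ => ?_)
    have h2 := hCA μ (2 * u (T * μ ^ 2)) hμ.1 hμ.2 (mul_nonneg zero_le_two (hu0 _))
    have h3 : 0 ≤ C * μ ^ p := by have := hμ.1; positivity
    rw [← ENNReal.ofReal_mul h3, ← ENNReal.ofReal_add
      (mul_nonneg h3 (hN.nonneg _ (mul_nonneg zero_le_two (hu0 _)))) (hN.nonneg _ ht₀)]
    refine ENNReal.ofReal_le_ofReal ?_
    rw [abs_of_pos hμ.1, show u (T * μ ^ 2) * (2 * μ) = μ * (2 * u (T * μ ^ 2)) by ring]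
    exact h2
  have hm1 : Measurable fun q : ℝ × ℝ => ENNReal.ofReal (C * q.2 ^ p) * N (q.1 * q.2 ^ 2) :=
    (ENNReal.measurable_ofReal.comp (measurable_const.mul (measurable_snd.pow_const p))).mul
      (hNm.comp (measurable_fst.mul (measurable_snd.pow_const 2)))
  calc ∫⁻ T in Ioc 0 R, ENNReal.ofReal (Φ (∫ l in (0 : ℝ)..1, u (T * l)))
      ≤ ∫⁻ T in Ioc 0 R, ∫⁻ μ in Ioc (0 : ℝ) 1,
        (ENNReal.ofReal (C * μ ^ p) * N (T * μ ^ 2) + ENNReal.ofReal (Φ t₀)) :=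
          lintegral_mono fun T => h1 T
    _ = (∫⁻ T in Ioc 0 R, ∫⁻ μ in Ioc (0 : ℝ) 1, ENNReal.ofReal (C * μ ^ p) * N (T * μ ^ 2)) +
        ENNReal.ofReal (Φ t₀) * ENNReal.ofReal R := by
          simp_rw [lintegral_add_right _ (measurable_const (a := ENNReal.ofReal (Φ t₀)))]
          rw [lintegral_add_right _ measurable_const]
          simp
    _ ≤ _ := by
          refine add_le_add ?_ le_rfl
          rw [lintegral_lintegral_swap hm1.aemeasurable, ← lintegral_mul_const _ (by fun_prop)]
          refine setLIntegral_mono' measurableSet_Ioc fun μ hμ => ?_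
          have hμ2 : 0 < μ ^ 2 := pow_pos hμ.1 2
          rw [lintegral_const_mul _ (show Measurable fun x => N (x * μ ^ 2) from
            hNm.comp (measurable_id.mul_const (μ ^ 2))),
            lintegral_Ioc_mul_right hμ2, ← mul_assoc,
            ← ENNReal.ofReal_mul (by have := hμ.1; positivity)]
          have hpow : C * μ ^ p * (μ ^ 2)⁻¹ = C * μ ^ (p - 2) := by
            rw [Real.rpow_sub hμ.1, Real.rpow_two]; ring
          rw [hpow]
          rcases le_or_gt R 0 with hR | hR
          · rw [Ioc_eq_empty (by nlinarith : ¬ (0 < R * μ ^ 2))]; simp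
          · refine mul_le_mul_right (lintegral_mono_set (Ioc_subset_Ioc_right ?_)) _
            exact mul_le_of_le_one_right hR.le (pow_le_one₀ hμ.1.le hμ.2)

/-- On the closed upper half plane `expI` has derivative of norm at most one, so the
variation of `f ∘ expI` along a segment is at most its length times a mean of `‖Df‖`. -/
theorem norm_sub_le_integral_path {f : ℂ → ℂ} (hf : ContDiff ℝ 1 f) {z w : ℂ} (hz : 0 ≤ z.im)
    (hw : 0 ≤ w.im) : ‖f (expI z) - f (expI (z + w))‖ ≤
      ‖w‖ * ∫ l in (0 : ℝ)..1, ‖fderiv ℝ f (expI (z + l * w))‖ := by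
  have hcf : Continuous (fderiv ℝ f) := hf.continuous_fderiv (by norm_num)
  have hE := continuous_expI
  have hd : ∀ l : ℝ, HasDerivAt (fun l : ℝ => f (expI (z + l * w)))
      (fderiv ℝ f (expI (z + l * w)) (expI (z + l * w) * (Complex.I * w))) l := by
    intro l
    have h1 : HasDerivAt (fun l : ℝ => expI (z + l * w))
        (expI (z + l * w) * (Complex.I * w)) l := by
      unfold expI
      have : HasDerivAt (fun l : ℝ => Complex.I * (z + l * w)) (Complex.I * w) l := by
        simpa using (((Complex.ofRealCLM.hasDerivAt (x := l)).mul_const w).const_add z).const_mul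
          Complex.I
      exact this.cexp
    exact ((hf.differentiable (by norm_num)) _).hasFDerivAt.comp_hasDerivAt l h1
  have hcd : Continuous fun l : ℝ =>
      fderiv ℝ f (expI (z + l * w)) (expI (z + l * w) * (Complex.I * w)) := by fun_prop
  have hftc := intervalIntegral.integral_eq_sub_of_hasDerivAt (a := 0) (b := 1)
    (fun l _ => hd l) (hcd.intervalIntegrable _ _)
  simp only [Complex.ofReal_one, one_mul, Complex.ofReal_zero, zero_mul, add_zero] at hftc
  rw [norm_sub_rev, ← hftc, ← intervalIntegral.integral_const_mul]
  refine intervalIntegral.norm_integral_le_of_norm_le zero_le_one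
    (Eventually.of_forall fun l hl => ?_) (Continuous.intervalIntegrable (by fun_prop) _ _)
  refine (ContinuousLinearMap.le_opNorm _ _).trans ?_
  rw [mul_comm]
  refine mul_le_mul_of_nonneg_right ?_ (norm_nonneg _)
  rw [norm_mul, norm_mul, Complex.norm_I, one_mul, norm_expI]
  refine mul_le_of_le_one_left (norm_nonneg _) (Real.exp_le_one_iff.2 ?_)
  have := mul_nonneg hl.1.le hw
  simp
  linarith

theorem norm_expI_sub_expI (s t : ℝ) :
    ‖expI s - expI (s + t : ℝ)‖ = 2 * |Real.sin (t / 2)| := by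
  have : expI s - expI (s + t : ℝ) = -(expI s * (expI t - 1)) := by
    push_cast; rw [expI_add]; ring
  rw [this, norm_neg, norm_mul, norm_expI, expI, Complex.norm_exp_I_mul_ofReal_sub_one]
  simp

theorem abs_le_two_mul_norm_expI_sub_expI (s : ℝ) {t : ℝ} (ht : |t| ≤ Real.pi) :
    |t| ≤ 2 * ‖expI s - expI (s + t : ℝ)‖ := by
  rw [norm_expI_sub_expI]
  have h1 : |Real.sin (t / 2)| = Real.sin (|t| / 2) := by
    rcases le_total 0 t with h | h
    · rw [abs_of_nonneg h] at ht ⊢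
      exact abs_of_nonneg (Real.sin_nonneg_of_nonneg_of_le_pi (by linarith) (by linarith))
    · rw [abs_of_nonpos h] at ht ⊢
      rw [neg_div, Real.sin_neg, abs_of_nonpos]
      exact Real.sin_nonpos_of_nonpos_of_neg_pi_le (by linarith) (by linarith)
  have h2 := Real.mul_le_sin (x := |t| / 2) (by positivity) (by linarith)
  rw [h1]
  have h3 : 2 / Real.pi * (|t| / 2) ≥ |t| / 4 := by
    rw [div_mul_div_comm, mul_comm 2 |t|, mul_div_mul_right _ _ two_ne_zero]
    exact div_le_div_of_nonneg_left (abs_nonneg t) Real.pi_pos Real.pi_le_four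
  linarith

/-- The difference quotient over a chord is controlled by means of the differential along a vertical,
a horizontal and a vertical segment in the coordinate `expI`. -/
theorem norm_divided_difference_le {f : ℂ → ℂ} (hf : ContDiff ℝ 1 f) (s : ℝ) {τ : ℝ}
    (hτ : |τ| ≤ Real.pi) :
    ‖(f (expI s) - f (expI (s + τ : ℝ))) / (expI s - expI (s + τ : ℝ))‖ ≤
      2 * (∫ l in (0 : ℝ)..1, ‖fderiv ℝ f (expI (s + (|τ| * l : ℝ) * Complex.I))‖) +
      2 * (∫ l in (0 : ℝ)..1, ‖fderiv ℝ f (expI ((s + l * τ : ℝ) + |τ| * Complex.I))‖) +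
      2 * (∫ l in (0 : ℝ)..1, ‖fderiv ℝ f (expI ((s + τ : ℝ) + (|τ| * l : ℝ) * Complex.I))‖) := by
  have hnn : ∀ F : ℝ → ℂ, 0 ≤ ∫ l in (0 : ℝ)..1, ‖fderiv ℝ f (F l)‖ := fun F =>
    intervalIntegral.integral_nonneg zero_le_one fun _ _ => norm_nonneg _
  rcases eq_or_ne τ 0 with rfl | h0
  · simp only [add_zero, sub_self, div_zero, norm_zero]
    have h1 := hnn (fun l => expI (s + (|(0 : ℝ)| * l : ℝ) * Complex.I))
    have h2 := hnn (fun l => expI ((s + l * 0 : ℝ) + |(0 : ℝ)| * Complex.I))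
    simp only [mul_zero, add_zero] at h1 h2 ⊢
    positivity
  have hT : 0 < |τ| := abs_pos.2 h0
  have a1 := norm_sub_le_integral_path hf (z := s) (w := |τ| * Complex.I) (by simp) (by simp)
  have a2 := norm_sub_le_integral_path hf (z := s + |τ| * Complex.I) (w := τ) (by simp) (by simp)
  have a3 := norm_sub_le_integral_path hf (z := (s + τ : ℝ)) (w := |τ| * Complex.I) (by simp)
    (by simp)
  have hn : ‖((|τ| : ℝ) : ℂ) * Complex.I‖ = |τ| := by simp
  rw [hn] at a1 a3
  rw [Complex.norm_real, Real.norm_eq_abs] at a2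
  have e1 : ∀ l : ℝ, (s : ℂ) + l * (|τ| * Complex.I) = s + (|τ| * l : ℝ) * Complex.I :=
    fun l => by push_cast; ring
  have e2 : ∀ l : ℝ, (s : ℂ) + |τ| * Complex.I + l * τ = (s + l * τ : ℝ) + |τ| * Complex.I :=
    fun l => by push_cast; ring
  have e3 : ∀ l : ℝ, ((s + τ : ℝ) : ℂ) + l * (|τ| * Complex.I) =
      (s + τ : ℝ) + (|τ| * l : ℝ) * Complex.I := fun l => by push_cast; ring
  have e4 : (s : ℂ) + |τ| * Complex.I + τ = ((s + τ : ℝ) : ℂ) + |τ| * Complex.I := by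
    push_cast; ring
  simp_rw [e1] at a1
  simp_rw [e2] at a2
  simp_rw [e3] at a3
  rw [e4] at a2
  have hchord := abs_le_two_mul_norm_expI_sub_expI s hτ
  have hpos : 0 < ‖expI s - expI (s + τ : ℝ)‖ := by linarith
  rw [norm_div, div_le_iff₀ hpos]
  have tri : ‖f (expI s) - f (expI (s + τ : ℝ))‖ ≤
      ‖f (expI s) - f (expI (s + |τ| * Complex.I))‖ +
      ‖f (expI (s + |τ| * Complex.I)) - f (expI ((s + τ : ℝ) + |τ| * Complex.I))‖ +
      ‖f (expI (s + τ : ℝ)) - f (expI ((s + τ : ℝ) + |τ| * Complex.I))‖ := by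
    rw [norm_sub_rev (f (expI (s + τ : ℝ)))]
    refine le_trans (le_of_eq ?_) (norm_add₃_le)
    congr 1; ring
  have h1 := hnn (fun l => expI (s + (|τ| * l : ℝ) * Complex.I))
  have h2 := hnn (fun l => expI ((s + l * τ : ℝ) + |τ| * Complex.I))
  have h3 := hnn (fun l => expI ((s + τ : ℝ) + (|τ| * l : ℝ) * Complex.I))
  set A := ∫ l in (0 : ℝ)..1, ‖fderiv ℝ f (expI (s + (|τ| * l : ℝ) * Complex.I))‖
  set B := ∫ l in (0 : ℝ)..1, ‖fderiv ℝ f (expI ((s + l * τ : ℝ) + |τ| * Complex.I))‖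
  set D := ∫ l in (0 : ℝ)..1, ‖fderiv ℝ f (expI ((s + τ : ℝ) + (|τ| * l : ℝ) * Complex.I))‖
  have h4 : |τ| * (A + B + D) ≤ 2 * ‖expI s - expI (s + τ : ℝ)‖ * (A + B + D) :=
    mul_le_mul_of_nonneg_right hchord (by positivity)
  linarith

/-- The part of the trace inequality that takes place in the `(x, y)`-coordinates: `G` plays the role of
the size of a differential, and `Q s τ` that of a difference quotient. The constant `12 = 2 * 3 * 2`
collects the factor `2` in the bound for `Q`, the number of summands, and the factor `2` in Hardy's
inequality. -/
theorem exists_lintegral_divided_difference_le {Φ : ℝ → ℝ} {p t₀ : ℝ} (hp : 1 < p) (ht₀ : 0 ≤ t₀)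
    (hN : IsNFunction Φ) (hc : Continuous Φ) (hA : AIncFrom Φ p t₀) :
    ∃ C D : ℝ≥0∞, C ≠ ∞ ∧ D ≠ ∞ ∧ ∀ G Q : ℝ → ℝ → ℝ, (Continuous fun q : ℝ × ℝ => G q.1 q.2) →
      (∀ x y, 0 ≤ G x y) → (∀ y, Function.Periodic (fun x => G x y) (2 * Real.pi)) →
      (∀ s τ, 0 ≤ Q s τ) →
      (∀ s τ, |τ| ≤ Real.pi → Q s τ ≤ 2 * (∫ l in (0 : ℝ)..1, G s (|τ| * l)) +
        2 * (∫ l in (0 : ℝ)..1, G (s + l * τ) |τ|) +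
        2 * (∫ l in (0 : ℝ)..1, G (s + τ) (|τ| * l))) →
      ∫⁻ s in Ioc 0 (2 * Real.pi), ∫⁻ τ in Ioc (-Real.pi) Real.pi, ENNReal.ofReal (Φ (Q s τ)) ≤
        C * (∫⁻ y in Ioc 0 Real.pi, ∫⁻ x in Ioc 0 (2 * Real.pi),
          ENNReal.ofReal (Φ (12 * G x y))) + D := by
  obtain ⟨C₁, hC₁, hardy⟩ := exists_hardy hp ht₀ hN hc hA
  set P : ℝ := 2 * Real.pi
  set E : ℝ≥0∞ := ENNReal.ofReal (Φ t₀) * ENNReal.ofReal Real.pi with hE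
  refine ⟨4 * C₁ + 2, 2 * (2 * E * ENNReal.ofReal P), by finiteness, by finiteness,
    fun G Q hGc hG0 hGper hQ0 hQ => ?_⟩
  have hGcomp : ∀ {X : Type} [TopologicalSpace X] {a b : X → ℝ}, Continuous a → Continuous b →
      Continuous fun x => G (a x) (b x) := fun ha hb => hGc.comp (ha.prodMk hb)
  set N : ℝ → ℝ → ℝ≥0∞ := fun x y => ENNReal.ofReal (Φ (12 * G x y)) with hNd
  have hNc : Continuous fun q : ℝ × ℝ => N q.1 q.2 :=
    ENNReal.continuous_ofReal.comp (hc.comp (continuous_const.mul hGc))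
  have hNcomp : ∀ {X : Type} [TopologicalSpace X] {a b : X → ℝ}, Continuous a → Continuous b →
      Continuous fun x => N (a x) (b x) := fun ha hb => hNc.comp (ha.prodMk hb)
  have hNper : ∀ y, Function.Periodic (fun x => N x y) P := fun y x => by
    simp only [hNd]; rw [show G (x + P) y = G x y from hGper y x]
  set V : ℝ → ℝ → ℝ≥0∞ := fun x T => ENNReal.ofReal (Φ (∫ l in (0 : ℝ)..1, 6 * G x (T * l)))
    with hV
  have hVc : Continuous fun q : ℝ × ℝ => V q.1 q.2 := by
    refine ENNReal.continuous_ofReal.comp (hc.comp ?_)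
    have h6 : Continuous (Function.uncurry fun (q : ℝ × ℝ) (l : ℝ) => 6 * G q.1 (q.2 * l)) :=
      continuous_const.mul (hGcomp (a := fun r : (ℝ × ℝ) × ℝ => r.1.1)
        (b := fun r => r.1.2 * r.2) (by fun_prop) (by fun_prop))
    exact intervalIntegral.continuous_parametric_intervalIntegral_of_continuous' h6 0 1
  have hVcomp : ∀ {X : Type} [TopologicalSpace X] {a b : X → ℝ}, Continuous a → Continuous b →
      Continuous fun x => V (a x) (b x) := fun ha hb => hVc.comp (ha.prodMk hb)
  have hVper : ∀ T, Function.Periodic (fun x => V x T) P := fun T x => by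
    simp only [hV]
    congr 3
    funext l
    rw [show G (x + P) (T * l) = G x (T * l) from hGper _ x]
  set M : ℝ≥0∞ := ∫⁻ y in Ioc 0 Real.pi, ∫⁻ x in Ioc 0 P, N x y with hM
  have hpt : ∀ s τ : ℝ, τ ∈ Ioc (-Real.pi) Real.pi → ENNReal.ofReal (Φ (Q s τ)) ≤
      V s |τ| + (∫⁻ l in Ioc (0 : ℝ) 1, N (s + l * τ) |τ|) + V (s + τ) |τ| := by
    intro s τ hτ
    have h := hQ s τ (abs_le.2 ⟨hτ.1.le, hτ.2⟩)
    have i1 : 0 ≤ ∫ l in (0 : ℝ)..1, G s (|τ| * l) :=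
      intervalIntegral.integral_nonneg zero_le_one fun _ _ => hG0 _ _
    have i2 : 0 ≤ ∫ l in (0 : ℝ)..1, G (s + l * τ) |τ| :=
      intervalIntegral.integral_nonneg zero_le_one fun _ _ => hG0 _ _
    have i3 : 0 ≤ ∫ l in (0 : ℝ)..1, G (s + τ) (|τ| * l) :=
      intervalIntegral.integral_nonneg zero_le_one fun _ _ => hG0 _ _
    have h2 := (hN.monotoneOn (mem_Ici.2 (hQ0 s τ)) (mem_Ici.2 (by positivity)) h).trans
      (hN.map_add_add_le (mul_nonneg zero_le_two i1) (mul_nonneg zero_le_two i2)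
        (mul_nonneg zero_le_two i3))
    have e : ∀ x : ℝ, 3 * (2 * x) = 6 * x := fun x => by ring
    rw [e, e, e, ← intervalIntegral.integral_const_mul, ← intervalIntegral.integral_const_mul,
      ← intervalIntegral.integral_const_mul] at h2
    refine (ENNReal.ofReal_le_ofReal h2).trans ?_
    refine ENNReal.ofReal_add_le.trans (add_le_add (ENNReal.ofReal_add_le.trans
      (add_le_add le_rfl ?_)) le_rfl)
    have : IsProbabilityMeasure (volume.restrict (Ioc (0 : ℝ) 1)) := ⟨by simp⟩
    rw [intervalIntegral.integral_of_le zero_le_one]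
    refine (ofReal_map_integral_le_lintegral hN hc (Continuous.integrableOn_Ioc ?_)
      (fun l => mul_nonneg (by norm_num) (hG0 _ _))).trans (lintegral_mono fun l => ?_)
    · exact continuous_const.mul (hGcomp (by fun_prop) (by fun_prop))
    · refine ENNReal.ofReal_le_ofReal (hN.monotoneOn (mem_Ici.2 ?_) (mem_Ici.2 ?_) ?_)
      · exact mul_nonneg (by norm_num) (hG0 _ _)
      · exact mul_nonneg (by norm_num) (hG0 _ _)
      · exact mul_le_mul_of_nonneg_right (by norm_num) (hG0 _ _)
  have hVm1 : Measurable fun q : ℝ × ℝ => V q.1 |q.2| :=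
    (hVcomp continuous_fst continuous_snd.abs).measurable
  have hVm2 : Measurable fun q : ℝ × ℝ => V (q.1 + q.2) |q.2| :=
    (hVcomp (continuous_fst.add continuous_snd) continuous_snd.abs).measurable
  have hNm : Measurable fun q : (ℝ × ℝ) × ℝ => N (q.1.1 + q.2 * q.1.2) |q.1.2| :=
    (hNcomp (by fun_prop) (by fun_prop)).measurable
  have hNm2 : Measurable fun q : ℝ × ℝ => ∫⁻ l in Ioc (0 : ℝ) 1, N (q.1 + l * q.2) |q.2| :=
    Measurable.lintegral_prod_right' hNm
  -- vertical segments: Hardy's inequality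
  have hvert : ∫⁻ s in Ioc 0 P, ∫⁻ τ in Ioc (-Real.pi) Real.pi, V s |τ| ≤
      2 * (C₁ * M) + 2 * E * ENNReal.ofReal P := by
    calc ∫⁻ s in Ioc 0 P, ∫⁻ τ in Ioc (-Real.pi) Real.pi, V s |τ|
        ≤ ∫⁻ s in Ioc 0 P, (2 * (C₁ * ∫⁻ y in Ioc 0 Real.pi, N s y) + 2 * E) := by
          refine lintegral_mono fun s => (lintegral_comp_abs_le (g := V s) Real.pi).trans ?_
          rw [← mul_add]
          refine mul_le_mul_right ?_ 2
          refine (hardy Real.pi (fun y => 6 * G s y)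
            (continuous_const.mul (hGcomp continuous_const continuous_id))
            (fun y => mul_nonneg (by norm_num) (hG0 _ _))).trans (le_of_eq ?_)
          simp only [hNd, hE]
          have : ∀ y, 2 * (6 * G s y) = 12 * G s y := fun y => by ring
          simp only [this]
      _ = 2 * (C₁ * M) + 2 * E * ENNReal.ofReal P := by
          rw [lintegral_add_right _ measurable_const, lintegral_const_mul, lintegral_const_mul,
            lintegral_lintegral_swap hNc.measurable.aemeasurable]
          · simp [hM]
          · exact Measurable.lintegral_prod_right' hNc.measurable
          · exact (Measurable.lintegral_prod_right' hNc.measurable).const_mul _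
  have hvert2 : ∫⁻ s in Ioc 0 P, ∫⁻ τ in Ioc (-Real.pi) Real.pi, V (s + τ) |τ| =
      ∫⁻ s in Ioc 0 P, ∫⁻ τ in Ioc (-Real.pi) Real.pi, V s |τ| := by
    rw [lintegral_lintegral_swap hVm2.aemeasurable, lintegral_lintegral_swap (f := fun s τ => V s |τ|) hVm1.aemeasurable]
    exact lintegral_congr fun τ => lintegral_period_add_right (hVper |τ|) τ
  have hhor : ∫⁻ s in Ioc 0 P, ∫⁻ τ in Ioc (-Real.pi) Real.pi,
      (∫⁻ l in Ioc (0 : ℝ) 1, N (s + l * τ) |τ|) ≤ 2 * M := by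
    rw [lintegral_lintegral_swap hNm2.aemeasurable]
    refine le_trans (le_of_eq ?_)
      (lintegral_comp_abs_le (g := fun y => ∫⁻ x in Ioc 0 P, N x y) Real.pi)
    refine lintegral_congr fun τ => ?_
    rw [lintegral_lintegral_swap]
    · rw [lintegral_congr fun l => lintegral_period_add_right (hNper |τ|) (l * τ)]
      simp
      rfl
    · exact (hNcomp (X := ℝ × ℝ) (by fun_prop) (by fun_prop)).measurable.aemeasurable
  calc _ ≤ ∫⁻ s in Ioc 0 P, ∫⁻ τ in Ioc (-Real.pi) Real.pi,
        (V s |τ| + (∫⁻ l in Ioc (0 : ℝ) 1, N (s + l * τ) |τ|) + V (s + τ) |τ|) :=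
        lintegral_mono fun s => setLIntegral_mono' measurableSet_Ioc (hpt s)
    _ = (∫⁻ s in Ioc 0 P, ∫⁻ τ in Ioc (-Real.pi) Real.pi, V s |τ|) +
        (∫⁻ s in Ioc 0 P, ∫⁻ τ in Ioc (-Real.pi) Real.pi,
          (∫⁻ l in Ioc (0 : ℝ) 1, N (s + l * τ) |τ|)) +
        ∫⁻ s in Ioc 0 P, ∫⁻ τ in Ioc (-Real.pi) Real.pi, V (s + τ) |τ| := by
        rw [← lintegral_add_left, ← lintegral_add_left]
        · refine lintegral_congr fun s => ?_
          rw [← lintegral_add_left, ← lintegral_add_left]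
          · exact (hVm1.comp measurable_prodMk_left).add (hNm2.comp measurable_prodMk_left)
          · exact hVm1.comp measurable_prodMk_left
        · exact (Measurable.lintegral_prod_right' hVm1).add
            (Measurable.lintegral_prod_right' hNm2)
        · exact Measurable.lintegral_prod_right' hVm1
    _ ≤ (2 * (C₁ * M) + 2 * E * ENNReal.ofReal P) + 2 * M +
        (2 * (C₁ * M) + 2 * E * ENNReal.ofReal P) := by
        rw [hvert2]
        gcongr
    _ = (4 * C₁ + 2) * M + 2 * (2 * E * ENNReal.ofReal P) := by ring

/-- The trace inequality for smooth maps: the `Φ`-Douglas energy of the boundary values is controlled by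
the `Φ`-energy in the disk. -/
theorem exists_trace_inequality {Φ : ℝ → ℝ} {p t₀ : ℝ} (hp : 1 < p) (ht₀ : 0 ≤ t₀)
    (hN : IsNFunction Φ) (hc : Continuous Φ) (hD : IsDoubling Φ) (hA : AIncFrom Φ p t₀) :
    ∃ C D : ℝ≥0∞, C ≠ ∞ ∧ D ≠ ∞ ∧ ∀ f : ℂ → ℂ, ContDiff ℝ 1 f →
      ∫⁻ s in Ioc 0 (2 * Real.pi), ∫⁻ τ in Ioc (-Real.pi) Real.pi, ENNReal.ofReal
        (Φ ‖(f (expI s) - f (expI (s + τ : ℝ))) / (expI s - expI (s + τ : ℝ))‖) ≤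
      C * (∫⁻ w in Metric.ball (0 : ℂ) 1, ENNReal.ofReal (Φ ‖fderiv ℝ f w‖)) + D := by
  obtain ⟨C₁, D, hC₁, hD', main⟩ := exists_lintegral_divided_difference_le hp ht₀ hN hc hA
  obtain ⟨C₂, hC₂, hdoub⟩ := hD.exists_map_mul_le hN (a := 12) (by norm_num)
  set P : ℝ := 2 * Real.pi
  refine ⟨C₁ * (ENNReal.ofReal (Real.exp P) * ENNReal.ofReal C₂), D, by finiteness, hD',
    fun f hf => ?_⟩
  have hcf : Continuous (fderiv ℝ f) := hf.continuous_fderiv (by norm_num)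
  have hcE := continuous_expI
  set G : ℝ → ℝ → ℝ := fun x y => ‖fderiv ℝ f (expI (x + y * Complex.I))‖ with hG
  have hG0 : ∀ x y, 0 ≤ G x y := fun x y => norm_nonneg _
  have hGper : ∀ y, Function.Periodic (fun x => G x y) P := fun y x => by
    simp only [hG, Complex.ofReal_add]
    rw [show (x : ℂ) + (P : ℝ) + y * Complex.I = x + y * Complex.I + (P : ℝ) by ring,
      expI_add_two_pi]
  have hGc : Continuous fun q : ℝ × ℝ => G q.1 q.2 := by simp only [hG]; fun_prop
  have hmain := main G _ hGc hG0 hGper (fun s τ => norm_nonneg _)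
    fun s τ hτ => norm_divided_difference_le hf s hτ
  have hMle : ∫⁻ y in Ioc 0 Real.pi, ∫⁻ x in Ioc 0 P, ENNReal.ofReal (Φ (12 * G x y)) ≤ ENNReal.ofReal (Real.exp P) * ENNReal.ofReal C₂ *
      ∫⁻ w in Metric.ball (0 : ℂ) 1, ENNReal.ofReal (Φ ‖fderiv ℝ f w‖) := by
    have hm : Measurable fun w : ℂ => ENNReal.ofReal (Φ ‖fderiv ℝ f w‖) :=
      (ENNReal.continuous_ofReal.comp (hc.comp hcf.norm)).measurable
    rw [lintegral_openDisk hm, ← lintegral_const_mul]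
    · refine (setLIntegral_mono' measurableSet_Ioc fun y hy => ?_).trans
        (lintegral_mono_set Ioc_subset_Ioi_self)
      rw [← mul_assoc,
        mul_right_comm _ _ (ENNReal.ofReal (Real.exp (-(2 * y)))), ← ENNReal.ofReal_mul (Real.exp_pos _).le, ← Real.exp_add]
      have h1 : (1 : ℝ≥0∞) ≤ ENNReal.ofReal (Real.exp (P + -(2 * y))) := by
        rw [← ENNReal.ofReal_one]
        refine ENNReal.ofReal_le_ofReal (Real.one_le_exp ?_)
        have := hy.2
        linarith
      calc ∫⁻ x in Ioc 0 P, ENNReal.ofReal (Φ (12 * G x y))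
          ≤ ∫⁻ x in Ioc 0 P, ENNReal.ofReal C₂ * ENNReal.ofReal (Φ (G x y)) := by
            refine lintegral_mono fun x => ?_
            rw [← ENNReal.ofReal_mul hC₂]
            exact ENNReal.ofReal_le_ofReal (hdoub _ (hG0 _ _))
        _ = 1 * ENNReal.ofReal C₂ * ∫⁻ x in Ioc 0 P, ENNReal.ofReal (Φ (G x y)) := by
            rw [lintegral_const_mul', one_mul]
            exact ENNReal.ofReal_ne_top
        _ ≤ _ := by gcongr
    · refine (by fun_prop : Measurable fun y : ℝ => ENNReal.ofReal (Real.exp (-(2 * y)))).mul ?_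
      exact Measurable.lintegral_prod_right' (f := fun q : ℝ × ℝ =>
        ENNReal.ofReal (Φ (G q.2 q.1)))
        (ENNReal.continuous_ofReal.comp (hc.comp (hGc.comp continuous_swap))).measurable
  refine hmain.trans ?_
  rw [mul_assoc C₁]
  gcongr

/-! ### Mollification and the Douglas condition of a trace -/

open Convolution in
/-- The differential of a mollification is the mollification of the weak differential: the kernel,
centred at `z`, is a test function as long as its support stays inside the disk. -/
theorem HasWeakDifferential.norm_fderiv_convolution_le {h h₁ : ℂ → ℂ} {g : ℂ → (ℂ →L[ℝ] ℂ)}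
    (hw : HasWeakDifferential openDisk h g) (hg : IntegrableOn g (Metric.ball 0 1))
    (hc : Continuous h₁) (hh : ∀ x ∈ Metric.ball (0 : ℂ) 1, h₁ x = h x) (ρ : ContDiffBump (0 : ℂ))
    {z : ℂ} (hz : ‖z‖ + ρ.rOut < 1) :
    ‖fderiv ℝ (ρ.normed volume ⋆[ContinuousLinearMap.lsmul ℝ ℝ, volume] h₁ : ℂ → ℂ) z‖ ≤
      ∫ x in Metric.ball (0 : ℂ) 1, ρ.normed volume (z - x) * ‖g x‖ := by
  set R : ℂ → ℝ := ρ.normed volume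
  have hRs : ContDiff ℝ (⊤ : ℕ∞) R := ρ.contDiff_normed
  have hRc : Continuous R := hRs.continuous
  have hR1 : ContDiff ℝ 1 R := ρ.contDiff_normed
  have hRcs : HasCompactSupport R := ρ.hasCompactSupport_normed
  have hR0 : ∀ x, 0 ≤ R x := ρ.nonneg_normed
  have hsupp : tsupport R = Metric.closedBall 0 ρ.rOut := ρ.tsupport_normed_eq
  -- the test function `x ↦ R (z - x)`
  have hηs : tsupport (fun x => R (z - x)) ⊆ Metric.closedBall z ρ.rOut := by
    refine closure_minimal (fun x hx => ?_) Metric.isClosed_closedBall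
    have : z - x ∈ tsupport R := subset_tsupport _ hx
    rw [hsupp, mem_closedBall_zero_iff] at this
    rwa [Metric.mem_closedBall, dist_comm, dist_eq_norm]
  have hball : Metric.closedBall z ρ.rOut ⊆ Metric.ball (0 : ℂ) 1 := fun x hx => by
    rw [Metric.mem_closedBall, dist_eq_norm] at hx
    rw [mem_ball_zero_iff]
    calc ‖x‖ = ‖z + (x - z)‖ := by congr 1; ring
      _ ≤ ‖z‖ + ‖x - z‖ := norm_add_le _ _
      _ < 1 := by linarith
  let η : TestFunction openDisk ℝ (⊤ : ℕ∞) :=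
    { toFun := fun x => R (z - x)
      contDiff' := hRs.comp (contDiff_const.sub contDiff_id)
      hasCompactSupport' :=
        HasCompactSupport.intro' (isCompact_closedBall z ρ.rOut) Metric.isClosed_closedBall
          fun x hx => image_eq_zero_of_notMem_tsupport (f := fun x => R (z - x)) fun h' => hx (hηs h')
      tsupport_subset' := hηs.trans hball }
  have hη : ∀ x, η x = R (z - x) := fun x => rfl
  have hηd : ∀ x v, fderiv ℝ η x v = -(fderiv ℝ R (z - x) v) := fun x v => by
    have h1 : HasFDerivAt (fun x : ℂ => z - x) (-ContinuousLinearMap.id ℝ ℂ) x :=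
      (hasFDerivAt_id x).const_sub z
    have h2 := ((hR1.differentiable (by norm_num)) (z - x)).hasFDerivAt.comp x h1
    rw [show (⇑η : ℂ → ℝ) = R ∘ fun x => z - x from rfl, h2.fderiv]
    simp
  have hd := hRcs.hasFDerivAt_convolution_left (ContinuousLinearMap.lsmul ℝ ℝ) hR1
    (hc.locallyIntegrable (μ := volume)) z
  have hdR : Continuous (fderiv ℝ R) := hR1.continuous_fderiv (by norm_num)
  have hex := (hRcs.fderiv ℝ).convolutionExists_left
    ((ContinuousLinearMap.lsmul ℝ ℝ : ℝ →L[ℝ] ℂ →L[ℝ] ℂ).precompL ℂ) hdR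
    (hc.locallyIntegrable (μ := volume)) z
  have hgi : Integrable (fun x => R (z - x) * ‖g x‖) (volume.restrict (Metric.ball 0 1)) := by
    obtain ⟨B, hB⟩ := hRcs.exists_bound_of_continuous hRc
    exact hg.norm.bdd_mul (c := B) (hRc.comp (continuous_const.sub continuous_id)).aestronglyMeasurable
      (Eventually.of_forall fun x => hB _)
  rw [hd.fderiv]
  refine ContinuousLinearMap.opNorm_le_bound _
    (integral_nonneg fun x => mul_nonneg (hR0 _) (norm_nonneg _)) fun v => ?_
  have key : (fderiv ℝ R ⋆[(ContinuousLinearMap.lsmul ℝ ℝ).precompL ℂ, volume] h₁) z v =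
      ∫ x in Metric.ball (0 : ℂ) 1, R (z - x) • g x v := by
    rw [convolution_def, ContinuousLinearMap.integral_apply hex]
    simp only [ContinuousLinearMap.precompL_apply, ContinuousLinearMap.lsmul_apply]
    rw [← integral_sub_left_eq_self _ volume z]
    simp only [sub_sub_cancel]
    rw [← setIntegral_eq_integral_of_forall_compl_eq_zero (s := Metric.ball (0 : ℂ) 1)]
    · have hw' := hw.integral_eq η v
      simp only [hη, hηd, neg_smul, integral_neg, neg_inj] at hw'
      refine Eq.trans (setIntegral_congr_fun Metric.isOpen_ball.measurableSet fun x hx => ?_) hw'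
      simp only [hh x hx]
    · intro x hx
      have : z - x ∉ tsupport (fderiv ℝ R) := fun h' => hx (hball (by
        have := tsupport_fderiv_subset ℝ h'
        rw [hsupp, mem_closedBall_zero_iff] at this
        rwa [Metric.mem_closedBall, dist_comm, dist_eq_norm]))
      rw [image_eq_zero_of_notMem_tsupport this]
      simp
  rw [key, ← integral_mul_const]
  refine norm_integral_le_of_norm_le (hgi.mul_const _) (Eventually.of_forall fun x => ?_)
  rw [norm_smul, Real.norm_of_nonneg (hR0 _), mul_assoc]
  exact mul_le_mul_of_nonneg_left (ContinuousLinearMap.le_opNorm _ _) (hR0 _)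

open Convolution in
/-- Mollification does not increase the `Φ`-energy, by Jensen's inequality. -/
theorem HasWeakDifferential.lintegral_fderiv_convolution_le {Φ : ℝ → ℝ} (hN : IsNFunction Φ)
    (hΦ : Continuous Φ) {h h₁ : ℂ → ℂ} {g : ℂ → (ℂ →L[ℝ] ℂ)}
    (hw : HasWeakDifferential openDisk h g) (hg : IntegrableOn g (Metric.ball 0 1))
    (hc : Continuous h₁) (hh : ∀ x ∈ Metric.ball (0 : ℂ) 1, h₁ x = h x) (ρ : ContDiffBump (0 : ℂ))
    {r : ℝ} (hr : r + ρ.rOut < 1) :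
    ∫⁻ z in Metric.ball (0 : ℂ) r, ENNReal.ofReal (Φ ‖fderiv ℝ
      (ρ.normed volume ⋆[ContinuousLinearMap.lsmul ℝ ℝ, volume] h₁ : ℂ → ℂ) z‖) ≤
      ∫⁻ z in Metric.ball (0 : ℂ) 1, ENNReal.ofReal (Φ ‖g z‖) := by
  set R : ℂ → ℝ := ρ.normed volume with hR
  have hR0 : ∀ x, 0 ≤ R x := ρ.nonneg_normed
  have hRc : Continuous R := ρ.continuous_normed
  have hRi : Integrable R volume := ρ.integrable_normed
  have hRb : ∃ B, ∀ x, ‖R x‖ ≤ B := ρ.hasCompactSupport_normed.exists_bound_of_continuous hRc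
  have hbm : MeasurableSet (Metric.ball (0 : ℂ) 1) := Metric.isOpen_ball.measurableSet
  -- a measurable version of the size of `g`, extended by zero
  obtain ⟨k, hkm, hk0, hki, hkae⟩ : ∃ k : ℂ → ℝ, Measurable k ∧ (∀ x, 0 ≤ k x) ∧ Integrable k ∧
      (Metric.ball (0 : ℂ) 1).indicator (fun x => ‖g x‖) =ᵐ[volume] k := by
    have hi : Integrable ((Metric.ball (0 : ℂ) 1).indicator fun x => ‖g x‖) :=
      (integrable_indicator_iff hbm).2 hg.norm
    have hae : (Metric.ball (0 : ℂ) 1).indicator (fun x => ‖g x‖) =ᵐ[volume]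
        fun x => |hi.aestronglyMeasurable.mk _ x| := by
      filter_upwards [hi.aestronglyMeasurable.ae_eq_mk] with x hx
      rw [← hx, abs_of_nonneg (indicator_nonneg (fun _ _ => norm_nonneg _) _)]
    exact ⟨_, (hi.aestronglyMeasurable.stronglyMeasurable_mk.measurable).abs,
      fun x => abs_nonneg _, hi.congr hae, hae⟩
  set ν : Measure ℂ := volume.withDensity fun x => ENNReal.ofReal (R x) with hν
  have hνp : IsProbabilityMeasure ν := ⟨by
    rw [hν, withDensity_apply _ MeasurableSet.univ, Measure.restrict_univ,
      ← ofReal_integral_eq_lintegral_ofReal hRi (Eventually.of_forall hR0), hR,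
      ρ.integral_normed, ENNReal.ofReal_one]⟩
  have hdm : Measurable fun x => ENNReal.ofReal (R x) := hRc.measurable.ennreal_ofReal
  have hpt : ∀ z ∈ Metric.ball (0 : ℂ) r, ENNReal.ofReal (Φ ‖fderiv ℝ
      (R ⋆[ContinuousLinearMap.lsmul ℝ ℝ, volume] h₁ : ℂ → ℂ) z‖) ≤
      ∫⁻ y, ENNReal.ofReal (Φ (k (z - y))) ∂ν := by
    intro z hz
    have h1 := hw.norm_fderiv_convolution_le hg hc hh ρ (z := z)
      (by rw [mem_ball_zero_iff] at hz; linarith)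
    have h2 : ∫ x in Metric.ball (0 : ℂ) 1, R (z - x) * ‖g x‖ = ∫ y, k (z - y) ∂ν := by
      rw [hν, integral_withDensity_eq_integral_toReal_smul hdm
        (Eventually.of_forall fun _ => ENNReal.ofReal_lt_top), ← integral_indicator hbm,
        ← integral_sub_left_eq_self _ volume z]
      refine integral_congr_ae ?_
      have hq := (Measure.measurePreserving_sub_left (volume : Measure ℂ) z).quasiMeasurePreserving
      filter_upwards [hq.ae_eq_comp hkae] with x hx
      simp only [Function.comp_apply] at hx
      rw [ENNReal.toReal_ofReal (hR0 _), ← hx, smul_eq_mul]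
      by_cases hm : z - x ∈ Metric.ball (0 : ℂ) 1
      · simp only [indicator_of_mem hm, sub_sub_cancel]
      · simp only [indicator_of_notMem hm, mul_zero]
    have hint : Integrable (fun y => k (z - y)) ν := by
      rw [hν, integrable_withDensity_iff_integrable_smul' hdm
        (Eventually.of_forall fun _ => ENNReal.ofReal_lt_top)]
      obtain ⟨B, hB⟩ := hRb
      refine (hki.comp_sub_left z).bdd_mul (c := B) ?_ (Eventually.of_forall fun x => ?_)
      · exact hdm.ennreal_toReal.aestronglyMeasurable
      · rw [ENNReal.toReal_ofReal (hR0 _)]; exact hB x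
    refine le_trans (ENNReal.ofReal_le_ofReal ?_)
      (ofReal_map_integral_le_lintegral hN hΦ hint fun y => hk0 _)
    refine hN.monotoneOn (mem_Ici.2 (norm_nonneg _))
      (mem_Ici.2 (integral_nonneg fun y => hk0 _)) ?_
    rw [← h2]
    exact h1
  have hΨ : Measurable fun x => ENNReal.ofReal (Φ (k x)) :=
    (hΦ.measurable.comp hkm).ennreal_ofReal
  calc _ ≤ ∫⁻ z in Metric.ball (0 : ℂ) r, ∫⁻ y, ENNReal.ofReal (Φ (k (z - y))) ∂ν :=
        setLIntegral_mono' Metric.isOpen_ball.measurableSet hpt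
    _ ≤ ∫⁻ z, ∫⁻ y, ENNReal.ofReal (Φ (k (z - y))) ∂ν := setLIntegral_le_lintegral _ _
    _ = ∫⁻ y, (∫⁻ z, ENNReal.ofReal (Φ (k (z - y)))) ∂ν :=
        lintegral_lintegral_swap (f := fun z y => ENNReal.ofReal (Φ (k (z - y))))
          (hΨ.comp (measurable_fst.sub measurable_snd)).aemeasurable
    _ = ∫⁻ z, ENNReal.ofReal (Φ (k z)) := by
        rw [lintegral_congr fun y =>
          lintegral_sub_right_eq_self (fun z => ENNReal.ofReal (Φ (k z))) y]
        simp
    _ = ∫⁻ z in Metric.ball (0 : ℂ) 1, ENNReal.ofReal (Φ ‖g z‖) := by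
        rw [← lintegral_indicator hbm]
        refine lintegral_congr_ae ?_
        filter_upwards [hkae] with x hx
        rw [← hx]
        by_cases hm : x ∈ Metric.ball (0 : ℂ) 1
        · simp only [indicator_of_mem hm]
        · simp only [indicator_of_notMem hm, hN.map_zero, ENNReal.ofReal_zero]

theorem lintegral_ball_comp_mul {g : ℂ → ℝ≥0∞} {r : ℝ} (hr : 0 < r) :
    ∫⁻ z in Metric.ball (0 : ℂ) 1, g (r • z) =
      ENNReal.ofReal ((r ^ 2)⁻¹) * ∫⁻ z in Metric.ball (0 : ℂ) r, g z := by
  have he : MeasurableEmbedding (fun x : ℂ => r • x) :=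
    (Homeomorph.smulOfNeZero r hr.ne').measurableEmbedding
  have hmem : ∀ x : ℂ, x ∈ Metric.ball (0 : ℂ) 1 ↔ r • x ∈ Metric.ball (0 : ℂ) r := fun x => by
    rw [mem_ball_zero_iff, mem_ball_zero_iff, norm_smul, Real.norm_of_nonneg hr.le,
      mul_lt_iff_lt_one_right hr]
  have h1 : ∀ x, (Metric.ball (0 : ℂ) 1).indicator (fun x => g (r • x)) x =
      (Metric.ball (0 : ℂ) r).indicator g (r • x) := fun x => by
    by_cases hx : x ∈ Metric.ball (0 : ℂ) 1
    · rw [indicator_of_mem hx, indicator_of_mem ((hmem x).1 hx)]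
    · rw [indicator_of_notMem hx, indicator_of_notMem (fun h => hx ((hmem x).2 h))]
  rw [← lintegral_indicator Metric.isOpen_ball.measurableSet,
    ← lintegral_indicator Metric.isOpen_ball.measurableSet]
  simp_rw [h1]
  rw [← he.lintegral_map (fun y => (Metric.ball (0 : ℂ) r).indicator g y),
    Measure.map_addHaar_smul volume hr.ne', lintegral_smul_measure, Complex.finrank_real_complex,
    abs_of_pos (by positivity), smul_eq_mul]

/-- The Douglas condition passes to boundary values that are pointwise limits of those of smooth maps
with bounded `Φ`-energy. -/
theorem douglasCondition_of_tendsto {Φ : ℝ → ℝ} {p t₀ : ℝ} (hp : 1 < p) (ht₀ : 0 ≤ t₀)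
    (hN : IsNFunction Φ) (hΦ : Continuous Φ) (hD : IsDoubling Φ) (hA : AIncFrom Φ p t₀)
    {φ : UnitCircle → ℂ} (hφc : Continuous φ) {f : ℕ → ℂ → ℂ} (hfs : ∀ n, ContDiff ℝ 1 (f n))
    (hflim : ∀ ξ : UnitCircle, Tendsto (fun n => f n ξ) atTop (𝓝 (φ ξ))) {B : ℝ≥0∞} (hB : B ≠ ∞)
    (henergy : ∀ n, ∫⁻ w in Metric.ball (0 : ℂ) 1,
      ENNReal.ofReal (Φ ‖fderiv ℝ (f n) w‖) ≤ B) :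
    DouglasCondition Φ φ := by
  obtain ⟨C, D, hC, hD', trace⟩ := exists_trace_inequality hp ht₀ hN hΦ hD hA
  set Q : ℕ → ℝ → ℝ → ℝ≥0∞ := fun n s τ => ENNReal.ofReal
    (Φ ‖(f n (expI s) - f n (expI (s + τ : ℝ))) / (expI s - expI (s + τ : ℝ))‖)
  have hQm : ∀ n, Measurable fun q : ℝ × ℝ => Q n q.1 q.2 := fun n => by
    have hE := continuous_expI
    have hfc := (hfs n).continuous
    refine (hΦ.measurable.comp (Measurable.norm (Measurable.div ?_ ?_))).ennreal_ofReal
    · exact Continuous.measurable (by fun_prop)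
    · exact Continuous.measurable (by fun_prop)
  have hQm1 : ∀ n s, Measurable fun τ : ℝ => Q n s τ := fun n s =>
    (hQm n).comp (f := fun τ => (s, τ)) measurable_prodMk_left
  have hbound : ∀ n, ∫⁻ s in Ioc 0 (2 * Real.pi), ∫⁻ τ in Ioc (-Real.pi) Real.pi, Q n s τ ≤
      C * B + D := fun n => (trace (f n) (hfs n)).trans (by gcongr; exact henergy n)
  have hKm : Measurable (Function.uncurry fun ξ η : UnitCircle =>
      ENNReal.ofReal (Φ ‖(φ ξ - φ η) / ((ξ : ℂ) - (η : ℂ))‖)) := by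
    refine (hΦ.measurable.comp (Measurable.norm (Measurable.div ?_ ?_))).ennreal_ofReal
    · exact Continuous.measurable (by fun_prop)
    · exact Continuous.measurable (by fun_prop)
  unfold DouglasCondition
  rw [lintegral_arcLength_arcLength hKm]
  have hlimQ : ∀ s τ : ℝ, ENNReal.ofReal (Φ ‖(φ (circlePoint s) - φ (circlePoint (s + τ))) /
      ((circlePoint s : ℂ) - (circlePoint (s + τ) : ℂ))‖) = liminf (fun n => Q n s τ) atTop := by
    intro s τ
    symm
    refine Tendsto.liminf_eq ((ENNReal.continuous_ofReal.tendsto _).comp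
      ((hΦ.tendsto _).comp (Tendsto.norm ?_)))
    simp only [← coe_circlePoint]
    exact ((hflim _).sub (hflim _)).div_const _
  refine lt_of_le_of_lt (b := C * B + D) ?_ (by finiteness)
  rw [lintegral_congr fun s => lintegral_congr fun τ => hlimQ s τ]
  calc ∫⁻ s in Ioc 0 (2 * Real.pi), ∫⁻ τ in Ioc (-Real.pi) Real.pi,
        liminf (fun n => Q n s τ) atTop
      ≤ ∫⁻ s in Ioc 0 (2 * Real.pi),
        liminf (fun n => ∫⁻ τ in Ioc (-Real.pi) Real.pi, Q n s τ) atTop :=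
        lintegral_mono fun s => lintegral_liminf_le fun n => hQm1 n s
    _ ≤ liminf (fun n => ∫⁻ s in Ioc 0 (2 * Real.pi),
        ∫⁻ τ in Ioc (-Real.pi) Real.pi, Q n s τ) atTop :=
        lintegral_liminf_le fun n => Measurable.lintegral_prod_right' (hQm n)
    _ ≤ C * B + D :=
        (liminf_le_limsup).trans (limsup_le_of_le (by isBoundedDefault)
          (Eventually.of_forall hbound))

open Convolution in
/-- A map that is continuous in the plane and lies in the Orlicz-Sobolev class of the disk is a limit of
dilated mollifications whose `Φ`-energy in the disk remains bounded. -/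
theorem exists_contDiff_tendsto {Φ : ℝ → ℝ} (hN : IsNFunction Φ) (hΦ : Continuous Φ)
    {h h₁ : ℂ → ℂ} {g : ℂ → (ℂ →L[ℝ] ℂ)} (hw : HasWeakDifferential openDisk h g)
    (hg : IntegrableOn g (Metric.ball 0 1)) (hc₁ : Continuous h₁)
    (hh : ∀ x ∈ Metric.ball (0 : ℂ) 1, h₁ x = h x) :
    ∃ f : ℕ → ℂ → ℂ, (∀ n, ContDiff ℝ 1 (f n)) ∧
      (∀ z, Tendsto (fun n => f n z) atTop (𝓝 (h₁ z))) ∧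
      ∀ n, ∫⁻ w in Metric.ball (0 : ℂ) 1, ENNReal.ofReal (Φ ‖fderiv ℝ (f n) w‖) ≤
        4 * ∫⁻ x in Metric.ball (0 : ℂ) 1, ENNReal.ofReal (Φ ‖g x‖) := by
  set r : ℕ → ℝ := fun n => 1 - 1 / ((n : ℝ) + 2) with hr
  have hrpos : ∀ n : ℕ, 0 < 1 / ((n : ℝ) + 2) := fun n => by positivity
  have hrle : ∀ n : ℕ, 1 / ((n : ℝ) + 2) ≤ 1 / 2 := fun n =>
    one_div_le_one_div_of_le two_pos (by linarith [n.cast_nonneg (α := ℝ)])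
  let ρ : ℕ → ContDiffBump (0 : ℂ) := fun n =>
    ⟨1 / ((n : ℝ) + 2) / 4, 1 / ((n : ℝ) + 2) / 2, by have := hrpos n; positivity,
      by have := hrpos n; linarith⟩
  have hρ : ∀ n, (ρ n).rOut = 1 / ((n : ℝ) + 2) / 2 := fun n => rfl
  set c : ℕ → ℂ → ℂ := fun n =>
    (ρ n).normed volume ⋆[ContinuousLinearMap.lsmul ℝ ℝ, volume] h₁
  have hcs : ∀ n, ContDiff ℝ 1 (c n) := fun n =>
    (ρ n).hasCompactSupport_normed.contDiff_convolution_left (n := 1) _ (ρ n).contDiff_normed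
      hc₁.locallyIntegrable
  set f : ℕ → ℂ → ℂ := fun n z => c n (r n • z) with hf
  have hfs : ∀ n, ContDiff ℝ 1 (f n) := fun n => (hcs n).comp (contDiff_id.const_smul (r n))
  have hlim0 : Tendsto (fun n : ℕ => 1 / ((n : ℝ) + 2)) atTop (𝓝 0) := by
    have := (tendsto_one_div_add_atTop_nhds_zero_nat (𝕜 := ℝ)).comp (tendsto_add_atTop_nat 1)
    refine this.congr fun n => ?_
    simp only [Function.comp_apply]
    push_cast
    ring
  have hrlim : Tendsto r atTop (𝓝 1) := by
    have := tendsto_const_nhds (x := (1 : ℝ)).sub hlim0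
    rwa [sub_zero] at this
  refine ⟨f, hfs, fun z => ?_, fun n => ?_⟩
  · refine ContDiffBump.convolution_tendsto_right (g := fun _ => h₁) (x₀ := z) ?_ ?_ ?_ ?_
    · simp only [hρ]
      simpa using hlim0.div_const 2
    · exact Eventually.of_forall fun n => hc₁.aestronglyMeasurable
    · exact (hc₁.tendsto z).comp tendsto_snd
    · simpa using hrlim.smul_const z
  · have h1 := hrpos n
    have h2 := hrle n
    have hr0 : 1 / 2 ≤ r n := by simp only [hr]; linarith
    have hr1 : r n ≤ 1 := by simp only [hr]; linarith
    calc _ ≤ ∫⁻ w in Metric.ball (0 : ℂ) 1, ENNReal.ofReal (Φ ‖fderiv ℝ (c n) (r n • w)‖) := by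
          refine lintegral_mono fun w => ENNReal.ofReal_le_ofReal
            (hN.monotoneOn (mem_Ici.2 (norm_nonneg _)) (mem_Ici.2 (norm_nonneg _)) ?_)
          simp only [hf]
          rw [fderiv_comp_smul, norm_smul, Real.norm_of_nonneg (by linarith)]
          exact mul_le_of_le_one_left (norm_nonneg _) hr1
      _ = ENNReal.ofReal ((r n ^ 2)⁻¹) *
          ∫⁻ w in Metric.ball (0 : ℂ) (r n), ENNReal.ofReal (Φ ‖fderiv ℝ (c n) w‖) :=
          lintegral_ball_comp_mul (g := fun w => ENNReal.ofReal (Φ ‖fderiv ℝ (c n) w‖))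
            (by linarith)
      _ ≤ 4 * ∫⁻ x in Metric.ball (0 : ℂ) 1, ENNReal.ofReal (Φ ‖g x‖) := by
          refine mul_le_mul' ?_ (hw.lintegral_fderiv_convolution_le hN hΦ hg hc₁
            hh (ρ n) ?_)
          · rw [show (4 : ℝ≥0∞) = ENNReal.ofReal 4 by simp]
            refine ENNReal.ofReal_le_ofReal (inv_le_of_inv_le₀ (by norm_num) ?_)
            nlinarith
          · rw [hρ]; simp only [hr]; linarith

/-- The boundary values of a map that is continuous on the closed disk and lies in the Orlicz-Sobolev
class satisfy the Douglas condition. The trace inequality is applied to dilated mollifications, which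
converge pointwise on the circle, and the limit is taken by Fatou's lemma. -/
theorem MemOrliczSobolev.douglasCondition {Φ : ℝ → ℝ} {p t₀ : ℝ} (hp : 1 < p) (ht₀ : 0 ≤ t₀)
    (hN : IsNFunction Φ) (hΦ : Continuous Φ) (hD : IsDoubling Φ) (hA : AIncFrom Φ p t₀)
    {φ : UnitCircle → ℂ} {h : ℂ → ℂ} (hc : ContinuousOn h (Metric.closedBall 0 1))
    (hφ : ∀ ξ : UnitCircle, h ξ = φ ξ) (hm : MemOrliczSobolev Φ openDisk h) :
    DouglasCondition Φ φ := by
  obtain ⟨-, g, hw, hg, hfin⟩ := hm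
  change IntegrableOn g (Metric.ball 0 1) at hg
  change ∫⁻ x in Metric.ball (0 : ℂ) 1, ENNReal.ofReal (Φ ‖g x‖) < ∞ at hfin
  -- a continuous extension of `h` to the plane
  set h₁ : ℂ → ℂ := fun z => h ((max 1 ‖z‖)⁻¹ • z) with hh₁
  have hmax : ∀ z : ℂ, 0 < max 1 ‖z‖ := fun z => lt_max_of_lt_left one_pos
  have hc₁ : Continuous h₁ := by
    refine hc.comp_continuous ?_ fun z => ?_
    · exact (Continuous.inv₀ (by fun_prop) fun z => (hmax z).ne').smul continuous_id
    · rw [mem_closedBall_zero_iff, norm_smul, norm_inv, Real.norm_of_nonneg (hmax z).le,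
        inv_mul_le_one₀ (hmax z)]
      exact le_max_right _ _
  have hh₁c : ∀ z : ℂ, ‖z‖ ≤ 1 → h₁ z = h z := fun z hz => by
    simp only [hh₁, max_eq_left hz, inv_one, one_smul]
  have hφc : Continuous φ := by
    have : φ = fun ξ : UnitCircle => h₁ ξ := funext fun ξ => by
      rw [← hφ, hh₁c _ (by simp)]
    rw [this]
    exact hc₁.comp continuous_subtype_val
  obtain ⟨f, hfs, hflim, hfe⟩ := exists_contDiff_tendsto hN hΦ hw hg hc₁
    fun x hx => hh₁c x (mem_ball_zero_iff.1 hx).le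
  refine douglasCondition_of_tendsto hp ht₀ hN hΦ hD hA hφc hfs (fun ξ => ?_) ?_ hfe
  · rw [← hφ, ← hh₁c ξ (by simp)]
    exact hflim ξ
  · have := hfin.ne
    finiteness

/-! ### Lifting a circle homeomorphism -/

theorem expI_eq_expI_iff {z w : ℂ} : expI z = expI w ↔ ∃ n : ℤ, z = w + (2 * Real.pi * n : ℝ) := by
  rw [expI, expI, Complex.exp_eq_exp_iff_exists_int]
  refine exists_congr fun n => ⟨fun h => ?_, fun h => ?_⟩
  · refine mul_left_cancel₀ Complex.I_ne_zero (h.trans ?_)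
    push_cast; ring
  · rw [h]; push_cast; ring

theorem expI_ofReal_eq_iff {s t : ℝ} : expI s = expI t ↔ ∃ n : ℤ, s = t + 2 * Real.pi * n := by
  rw [expI_eq_expI_iff]
  exact exists_congr fun n => by exact_mod_cast Iff.rfl

theorem exists_lift {f : ℝ → ℂ} (hf : Continuous f) (h1 : ∀ θ, ‖f θ‖ = 1) :
    ∃ ψ : ℝ → ℝ, Continuous ψ ∧ ∀ θ, expI (ψ θ) = f θ := by
  have hsc : IsSimplyConnected (univ : Set ℝ) :=
    have := convex_univ.contractibleSpace (E := ℝ) univ_nonempty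
    SimplyConnectedSpace.ofContractible _
  obtain ⟨g, hg, hexp⟩ := Complex.exists_continuousOn_eqOn_exp_comp (X := ℝ) (U := univ)
    hsc isOpen_univ
    hf.continuousOn (by rintro ⟨θ, -, h⟩; have := h1 θ; simp [h] at this)
  refine ⟨fun θ => (g θ).im, Complex.continuous_im.comp (continuousOn_univ.1 hg), fun θ => ?_⟩
  have h2 : Complex.exp (g θ) = f θ := hexp (mem_univ θ)
  have h3 : (g θ).re = 0 := by
    have := h1 θ
    rw [← h2, Complex.norm_exp, Real.exp_eq_one_iff] at this
    exact this
  rw [← h2, expI]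
  congr 1
  apply Complex.ext <;> simp [h3]

theorem exists_forall_eq_intCast {g : ℝ → ℝ} (hg : Continuous g)
    (h : ∀ θ, ∃ n : ℤ, g θ = n) : ∃ n : ℤ, ∀ θ, g θ = n := by
  choose m hm using h
  have hmc : Continuous m := Int.isClosedEmbedding_coe_real.isInducing.continuous_iff.2
    (hg.congr hm)
  exact ⟨m 0, fun θ => by rw [hm θ, PreconnectedSpace.constant inferInstance hmc (x := θ) (y := 0)]⟩

theorem exists_forall_eq_add_two_pi_mul {f g : ℝ → ℝ} (hf : Continuous f) (hg : Continuous g)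
    (h : ∀ θ, expI (f θ) = expI (g θ)) : ∃ n : ℤ, ∀ θ, f θ = g θ + 2 * Real.pi * n := by
  have hpi := Real.two_pi_pos.ne'
  obtain ⟨n, hn⟩ := exists_forall_eq_intCast (g := fun θ => (f θ - g θ) / (2 * Real.pi))
    ((hf.sub hg).div_const _) fun θ => by
      obtain ⟨n, hn⟩ := expI_ofReal_eq_iff.1 (h θ)
      exact ⟨n, by rw [hn]; field_simp; ring⟩
  refine ⟨n, fun θ => ?_⟩
  have := hn θ
  rw [div_eq_iff hpi] at this
  linarith

/-- A circle homeomorphism is, up to a reflection, induced by an increasing map of the real line that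
commutes with the translation by `2π`. -/
theorem exists_strictMono_lift (φ : UnitCircle ≃ₜ UnitCircle) :
    ∃ (c : ℂ ≃ₗᵢ[ℝ] ℂ) (ψ : ℝ → ℝ), Continuous ψ ∧ StrictMono ψ ∧
      (∀ θ, ψ (θ + 2 * Real.pi) = ψ θ + 2 * Real.pi) ∧
      ∀ θ, (φ (circlePoint θ) : ℂ) = c (expI (ψ θ)) := by
  have hpi := Real.two_pi_pos
  have lift : ∀ F : UnitCircle ≃ₜ UnitCircle, ∃ ψ : ℝ → ℝ, Continuous ψ ∧
      ∀ θ, circlePoint (ψ θ) = F (circlePoint θ) := fun F => by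
    obtain ⟨ψ, h1, h2⟩ := exists_lift (f := fun θ => (F (circlePoint θ) : ℂ))
      (continuous_subtype_val.comp (F.continuous.comp continuous_circlePoint)) (fun θ => by simp)
    exact ⟨ψ, h1, fun θ => Subtype.ext (by rw [coe_circlePoint, h2])⟩
  have degree : ∀ {F : UnitCircle ≃ₜ UnitCircle} {ψ : ℝ → ℝ}, Continuous ψ →
      (∀ θ, circlePoint (ψ θ) = F (circlePoint θ)) →
      ∃ k : ℤ, ∀ θ, ψ (θ + 2 * Real.pi) = ψ θ + 2 * Real.pi * k := fun {F ψ} hψ h =>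
    exists_forall_eq_add_two_pi_mul (hψ.comp (continuous_add_const _)) hψ fun θ => by
      rw [← coe_circlePoint, ← coe_circlePoint, h, h, circlePoint_add_two_pi]
  obtain ⟨ψ, hψ, hψφ⟩ := lift φ
  obtain ⟨χ, hχ, hχφ⟩ := lift φ.symm
  obtain ⟨k, hk⟩ := degree hψ hψφ
  obtain ⟨l, hl⟩ := degree hχ hχφ
  obtain ⟨m, hm⟩ := exists_forall_eq_add_two_pi_mul (hχ.comp hψ) continuous_id fun θ => by
    rw [← coe_circlePoint, ← coe_circlePoint, Function.comp_apply, hχφ, hψφ, φ.symm_apply_apply]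
    rfl
  simp only [Function.comp_apply, id_eq] at hm
  have hinj : Function.Injective ψ := fun s t hst => by
    have h1 := hm s
    rw [hst, hm t] at h1
    linarith
  have hkl : k * l = 1 := by
    have hper : Function.Periodic (fun t => χ t - l * t) (2 * Real.pi) := fun t => by
      simp only [hl]; ring
    have h1 := hper.int_mul k (ψ 0)
    have h2 := hm (0 + 2 * Real.pi)
    rw [hk, mul_comm (2 * Real.pi) (k : ℝ)] at h2
    simp only [h2, hm] at h1
    have h3 : ((k * l : ℤ) : ℝ) = 1 := by
      push_cast
      have : 2 * Real.pi * ((k : ℝ) * l - 1) = 0 := by linarith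
      have := (mul_eq_zero.1 this).resolve_left hpi.ne'
      linarith
    exact_mod_cast h3
  rcases hψ.strictMono_of_inj hinj with hmono | hanti
  · have hk1 : k = 1 := by
      rcases Int.eq_one_or_neg_one_of_mul_eq_one hkl with h | h
      · exact h
      · have h1 := hmono (show (0 : ℝ) < 0 + 2 * Real.pi by linarith)
        rw [hk, h] at h1
        push_cast at h1
        linarith
    refine ⟨LinearIsometryEquiv.refl ℝ ℂ, ψ, hψ, hmono, fun θ => ?_, fun θ => ?_⟩
    · rw [hk, hk1]; simp
    · rw [← hψφ, coe_circlePoint]; rfl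
  · have hk1 : k = -1 := by
      rcases Int.eq_one_or_neg_one_of_mul_eq_one hkl with h | h
      · have h1 := hanti (show (0 : ℝ) < 0 + 2 * Real.pi by linarith)
        rw [hk, h] at h1
        push_cast at h1
        linarith
      · exact h
    refine ⟨Complex.conjLIE, fun θ => -ψ θ, hψ.neg, fun s t hst => neg_lt_neg (hanti hst),
      fun θ => ?_, fun θ => ?_⟩
    · simp only [hk, hk1]; push_cast; ring
    · rw [← hψφ, coe_circlePoint, Complex.conjLIE_apply, expI, expI, ← Complex.exp_conj]
      congr 1
      simp

/-! ### The Beurling-Ahlfors extension -/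

/-- An increasing lift of a circle homeomorphism: a continuous strictly increasing map of the line that
commutes with the translation by `2π`. -/
structure IsCircleLift (ψ : ℝ → ℝ) : Prop where
  continuous : Continuous ψ
  strictMono : StrictMono ψ
  map_add_two_pi : ∀ θ, ψ (θ + 2 * Real.pi) = ψ θ + 2 * Real.pi

/-- The mean of `ψ` over the segment from `x` to `x + y`, for `y` of either sign. -/
def segmentMean (ψ : ℝ → ℝ) (x y : ℝ) : ℝ := ∫ t in (0 : ℝ)..1, ψ (x + t * y)

/-- The Beurling-Ahlfors extension of `ψ`, in terms of the means of `ψ` over `[x, x + y]` and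
`[x - y, x]`. The imaginary part is twice the usual one, so that `beurlingAhlfors ψ z - z` is
bounded. -/
def beurlingAhlfors (ψ : ℝ → ℝ) (z : ℂ) : ℂ :=
  ⟨(segmentMean ψ z.re z.im + segmentMean ψ z.re (-z.im)) / 2,
    segmentMean ψ z.re z.im - segmentMean ψ z.re (-z.im)⟩

/-- The Beurling-Ahlfors extension transported to the disk by `expI`. The point `-i log w` is the
preimage of `w` under `expI` in the strip `-π < x ≤ π`. -/
def diskExtension (ψ : ℝ → ℝ) (w : ℂ) : ℂ :=
  if w = 0 then 0 else expI (beurlingAhlfors ψ (-Complex.I * Complex.log w))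

namespace IsCircleLift

variable {ψ : ℝ → ℝ}

theorem map_add_int_mul (h : IsCircleLift ψ) (θ : ℝ) (n : ℤ) :
    ψ (θ + 2 * Real.pi * n) = ψ θ + 2 * Real.pi * n := by
  have hper : Function.Periodic (fun t => ψ t - t) (2 * Real.pi) := fun t => by
    simp only [h.map_add_two_pi]; ring
  have := hper.int_mul n θ
  simp only [mul_comm (n : ℝ)] at this
  linarith

theorem abs_sub_sub_le (h : IsCircleLift ψ) (s t : ℝ) :
    |ψ s - ψ t - (s - t)| ≤ 2 * Real.pi := by
  obtain ⟨n, hn, -⟩ := existsUnique_add_zsmul_mem_Ico Real.two_pi_pos s t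
  simp only [zsmul_eq_mul, mul_comm (n : ℝ)] at hn
  have h1 := h.map_add_int_mul s n
  have h2 := h.strictMono.monotone hn.1
  have h3 := h.strictMono.monotone hn.2.le
  rw [h.map_add_two_pi] at h3
  rw [abs_le]
  constructor <;> linarith [hn.1, hn.2]

theorem continuous_segmentMean (h : IsCircleLift ψ) :
    Continuous fun q : ℝ × ℝ => segmentMean ψ q.1 q.2 := by
  have hc := h.continuous
  have : Continuous (Function.uncurry fun (q : ℝ × ℝ) (t : ℝ) => ψ (q.1 + t * q.2)) := by
    simp only [Function.uncurry_def]
    fun_prop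
  exact intervalIntegral.continuous_parametric_intervalIntegral_of_continuous' this 0 1

theorem segmentMean_zero (x : ℝ) : segmentMean ψ x 0 = ψ x := by simp [segmentMean]

theorem segmentMean_lt (h : IsCircleLift ψ) {x x' y y' : ℝ} (hx : x ≤ x') (hy : y ≤ y')
    (hne : x < x' ∨ y < y') : segmentMean ψ x y < segmentMean ψ x' y' := by
  have hc := h.continuous
  have hle : ∀ t, 0 ≤ t → x + t * y ≤ x' + t * y' := fun t ht =>
    add_le_add hx (mul_le_mul_of_nonneg_left hy ht)
  refine intervalIntegral.integral_lt_integral_of_continuousOn_of_le_of_exists_lt zero_lt_one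
    (by fun_prop) (by fun_prop) (fun t ht => h.strictMono.monotone (hle t ht.1.le))
    ⟨1, by simp, h.strictMono ?_⟩
  rcases hne with h' | h' <;> linarith

theorem abs_segmentMean_sub_le (h : IsCircleLift ψ) (x y : ℝ) :
    |segmentMean ψ x y - ψ x - y / 2| ≤ 2 * Real.pi := by
  have hc := h.continuous
  have h1 : segmentMean ψ x y - ψ x - y / 2 =
      ∫ t in (0 : ℝ)..1, (ψ (x + t * y) - ψ x - t * y) := by
    rw [intervalIntegral.integral_sub, intervalIntegral.integral_sub,
      intervalIntegral.integral_mul_const, integral_id]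
    · simp [segmentMean]; ring
    all_goals exact Continuous.intervalIntegrable (by fun_prop) _ _
  rw [h1, ← Real.norm_eq_abs]
  refine (intervalIntegral.norm_integral_le_of_norm_le_const (C := 2 * Real.pi)
    fun t _ => ?_).trans (by simp)
  have := h.abs_sub_sub_le (x + t * y) x
  rwa [add_sub_cancel_left] at this

theorem segmentMean_add_two_pi (h : IsCircleLift ψ) (x y : ℝ) (n : ℤ) :
    segmentMean ψ (x + 2 * Real.pi * n) y = segmentMean ψ x y + 2 * Real.pi * n := by
  have hc := h.continuous
  have : ∀ t, ψ (x + 2 * Real.pi * n + t * y) = ψ (x + t * y) + 2 * Real.pi * n := fun t => by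
    rw [← h.map_add_int_mul]; congr 1; ring
  simp only [segmentMean, this]
  rw [intervalIntegral.integral_add]
  · simp
  all_goals exact Continuous.intervalIntegrable (by fun_prop) _ _

theorem continuous_beurlingAhlfors (h : IsCircleLift ψ) : Continuous (beurlingAhlfors ψ) := by
  have h1 : Continuous fun z : ℂ => segmentMean ψ z.re z.im :=
    h.continuous_segmentMean.comp (Complex.continuous_re.prodMk Complex.continuous_im)
  have h2 : Continuous fun z : ℂ => segmentMean ψ z.re (-z.im) :=
    h.continuous_segmentMean.comp (Complex.continuous_re.prodMk Complex.continuous_im.neg)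
  exact Complex.equivRealProdCLM.symm.continuous.comp
    (((h1.add h2).div_const 2).prodMk (h1.sub h2))

theorem beurlingAhlfors_add_two_pi (h : IsCircleLift ψ) (z : ℂ) (n : ℤ) :
    beurlingAhlfors ψ (z + (2 * Real.pi * n : ℝ)) =
      beurlingAhlfors ψ z + (2 * Real.pi * n : ℝ) := by
  apply Complex.ext
  · simp only [beurlingAhlfors, Complex.add_re, Complex.add_im, Complex.ofReal_re,
      Complex.ofReal_im, add_zero, h.segmentMean_add_two_pi]
    ring
  · simp only [beurlingAhlfors, Complex.add_re, Complex.add_im, Complex.ofReal_re,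
      Complex.ofReal_im, add_zero, h.segmentMean_add_two_pi]
    ring

theorem beurlingAhlfors_ofReal (x : ℝ) : beurlingAhlfors ψ x = ψ x := by
  apply Complex.ext <;> simp [beurlingAhlfors, segmentMean_zero]

theorem beurlingAhlfors_im_nonneg (h : IsCircleLift ψ) {z : ℂ} (hz : 0 ≤ z.im) :
    0 ≤ (beurlingAhlfors ψ z).im := by
  simp only [beurlingAhlfors, sub_nonneg]
  rcases hz.eq_or_lt with h0 | h0
  · rw [← h0, neg_zero]
  · exact (h.segmentMean_lt le_rfl (by linarith) (Or.inr (by linarith))).le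

theorem le_beurlingAhlfors_im (h : IsCircleLift ψ) (z : ℂ) :
    z.im - 4 * Real.pi ≤ (beurlingAhlfors ψ z).im := by
  have h1 := abs_le.1 (h.abs_segmentMean_sub_le z.re z.im)
  have h2 := abs_le.1 (h.abs_segmentMean_sub_le z.re (-z.im))
  simp only [beurlingAhlfors]
  linarith [h1.1, h2.2]

/-- Of two distinct points of the half plane, one lies to the right of the other; its mean to the right is
then larger if it is not lower, and its mean to the left is larger if it is not higher. -/
theorem injOn_beurlingAhlfors (h : IsCircleLift ψ) :
    InjOn (beurlingAhlfors ψ) {z | 0 ≤ z.im} := by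
  have key : ∀ z w : ℂ, z.re ≤ w.re → beurlingAhlfors ψ z = beurlingAhlfors ψ w → z = w := by
    intro z w hzw he
    have h1 := congrArg Complex.re he
    have h2 := congrArg Complex.im he
    simp only [beurlingAhlfors] at h1 h2
    by_contra hne
    have hne' : z.re < w.re ∨ z.im ≠ w.im := by
      by_contra! hcon
      exact hne (Complex.ext (le_antisymm hzw hcon.1) hcon.2)
    rcases le_total z.im w.im with hy | hy
    · have := h.segmentMean_lt hzw hy (hne'.imp id fun h' => lt_of_le_of_ne hy h')
      linarith
    · have := h.segmentMean_lt hzw (neg_le_neg hy)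
        (hne'.imp id fun h' => neg_lt_neg (lt_of_le_of_ne hy (Ne.symm h')))
      linarith
  intro z _ w _ he
  rcases le_total z.re w.re with h' | h'
  · exact key z w h' he
  · exact (key w z h' he.symm).symm

/-- For each height `y` there is exactly one `X y` at which the mean to the right is the prescribed `a`;
the mean to the left of `X y` is continuous in `y`, and the intermediate value theorem applies. -/
theorem surjOn_beurlingAhlfors (h : IsCircleLift ψ) :
    SurjOn (beurlingAhlfors ψ) {z | 0 ≤ z.im} {z | 0 ≤ z.im} := by
  intro ζ hζ
  simp only [mem_ofPred_eq] at hζ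
  set a := ζ.re + ζ.im / 2 with ha
  set b := ζ.re - ζ.im / 2 with hb
  have hex : ∀ y, ∃ x, segmentMean ψ x y = a := by
    intro y
    have hc : Continuous fun x => segmentMean ψ x y :=
      h.continuous_segmentMean.comp (continuous_id.prodMk continuous_const)
    have hest : ∀ x, |segmentMean ψ x y - (x + ψ 0 + y / 2)| ≤ 4 * Real.pi := fun x => by
      have h1 := abs_le.1 (h.abs_segmentMean_sub_le x y)
      have h2 := abs_le.1 (h.abs_sub_sub_le x 0)
      rw [abs_le]
      constructor <;> linarith [h1.1, h1.2, h2.1, h2.2]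
    refine mem_range_of_exists_le_of_exists_ge hc
      ⟨a - ψ 0 - y / 2 - 4 * Real.pi, ?_⟩ ⟨a - ψ 0 - y / 2 + 4 * Real.pi, ?_⟩
    · linarith [(abs_le.1 (hest (a - ψ 0 - y / 2 - 4 * Real.pi))).2]
    · linarith [(abs_le.1 (hest (a - ψ 0 - y / 2 + 4 * Real.pi))).1]
  choose X hX using hex
  have hmono : ∀ y {x x'}, segmentMean ψ x y < segmentMean ψ x' y → x < x' := fun y x x' hlt => by
    by_contra! hcon
    rcases hcon.eq_or_lt with h' | h'
    · rw [h'] at hlt; exact lt_irrefl _ hlt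
    · exact lt_asymm hlt (h.segmentMean_lt hcon le_rfl (Or.inl h'))
  have hcont : ∀ x, Continuous fun y => segmentMean ψ x y := fun x =>
    h.continuous_segmentMean.comp (continuous_const.prodMk continuous_id)
  have hXc : Continuous X := by
    refine continuous_iff_continuousAt.2 fun y₀ => tendsto_order.2 ⟨fun x hx => ?_, fun x hx => ?_⟩
    · have h1 : segmentMean ψ x y₀ < a := by
        rw [← hX y₀]; exact h.segmentMean_lt hx.le le_rfl (Or.inl hx)
      filter_upwards [((hcont x).tendsto y₀).eventually (gt_mem_nhds h1)] with y hy
      exact hmono y (by rw [hX]; exact hy)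
    · have h1 : a < segmentMean ψ x y₀ := by
        rw [← hX y₀]; exact h.segmentMean_lt hx.le le_rfl (Or.inl hx)
      filter_upwards [((hcont x).tendsto y₀).eventually (lt_mem_nhds h1)] with y hy
      exact hmono y (by rw [hX]; exact hy)
  have hBc : Continuous fun y => segmentMean ψ (X y) (-y) :=
    h.continuous_segmentMean.comp (hXc.prodMk continuous_neg)
  have hY : 0 ≤ ζ.im + 4 * Real.pi := by positivity
  have h0 : b ≤ segmentMean ψ (X 0) (-0) := by
    rw [neg_zero, hX]; linarith
  have h1 : segmentMean ψ (X (ζ.im + 4 * Real.pi)) (-(ζ.im + 4 * Real.pi)) ≤ b := by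
    have := h.le_beurlingAhlfors_im ⟨X (ζ.im + 4 * Real.pi), ζ.im + 4 * Real.pi⟩
    simp only [beurlingAhlfors, hX] at this
    linarith
  obtain ⟨y, hy, hyb⟩ := intermediate_value_Icc' hY hBc.continuousOn ⟨h1, h0⟩
  refine ⟨⟨X y, y⟩, hy.1, ?_⟩
  simp only at hyb
  apply Complex.ext
  · simp only [beurlingAhlfors, hX, hyb]; linarith
  · simp only [beurlingAhlfors, hX, hyb]; linarith

end IsCircleLift

theorem expI_log {w : ℂ} (hw : w ≠ 0) : expI (-Complex.I * Complex.log w) = w := by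
  rw [expI, ← mul_assoc, mul_neg, Complex.I_mul_I, neg_neg, one_mul, Complex.exp_log hw]

theorem expI_ne_zero (z : ℂ) : expI z ≠ 0 := Complex.exp_ne_zero _

theorem exists_expI_eq {w : ℂ} (hw : w ≠ 0) (hw1 : ‖w‖ ≤ 1) : ∃ z : ℂ, 0 ≤ z.im ∧ expI z = w := by
  refine ⟨_, ?_, expI_log hw⟩
  simp [Complex.log_re, Real.log_nonpos (norm_nonneg w) hw1]

namespace IsCircleLift

variable {ψ : ℝ → ℝ}

theorem diskExtension_expI (h : IsCircleLift ψ) (z : ℂ) :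
    diskExtension ψ (expI z) = expI (beurlingAhlfors ψ z) := by
  rw [diskExtension, if_neg (expI_ne_zero z)]
  obtain ⟨n, hn⟩ := expI_eq_expI_iff.1 (expI_log (expI_ne_zero z))
  rw [hn, h.beurlingAhlfors_add_two_pi, expI_eq_expI_iff]
  exact ⟨n, rfl⟩

theorem norm_diskExtension_le (h : IsCircleLift ψ) (w : ℂ) :
    ‖diskExtension ψ w‖ ≤ Real.exp (4 * Real.pi) * ‖w‖ := by
  rcases eq_or_ne w 0 with rfl | hw
  · simp [diskExtension]
  · rw [← expI_log hw, h.diskExtension_expI, norm_expI, norm_expI, ← Real.exp_add]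
    refine Real.exp_le_exp.2 ?_
    have := h.le_beurlingAhlfors_im (-Complex.I * Complex.log w)
    linarith

/-- Near a point `expI z` the disk extension factors through a local inverse of `expI`. -/
theorem diskExtension_eventuallyEq (h : IsCircleLift ψ) (z : ℂ) :
    diskExtension ψ =ᶠ[𝓝 (expI z)] fun w =>
      expI (beurlingAhlfors ψ (z + -Complex.I * Complex.log (w / expI z))) := by
  filter_upwards [isOpen_ne.mem_nhds (expI_ne_zero z)] with w hw
  rw [← h.diskExtension_expI, expI_add, expI_log (div_ne_zero hw (expI_ne_zero z)),
    mul_div_cancel₀ _ (expI_ne_zero z)]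

theorem continuous_diskExtension (h : IsCircleLift ψ) : Continuous (diskExtension ψ) := by
  refine continuous_iff_continuousAt.2 fun w => ?_
  rcases eq_or_ne w 0 with rfl | hw
  · have h0 : diskExtension ψ 0 = 0 := by simp [diskExtension]
    rw [ContinuousAt, h0]
    refine squeeze_zero_norm h.norm_diskExtension_le ?_
    have : Continuous fun w : ℂ => Real.exp (4 * Real.pi) * ‖w‖ := by fun_prop
    simpa using this.tendsto 0
  · rw [← expI_log hw]
    set z := -Complex.I * Complex.log w
    refine ContinuousAt.congr ?_ (h.diskExtension_eventuallyEq z).symm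
    refine (continuous_expI.comp h.continuous_beurlingAhlfors).continuousAt.comp ?_
    refine continuousAt_const.add (continuousAt_const.mul (ContinuousAt.clog ?_ ?_))
    · exact continuousAt_id.div_const _
    · rw [div_self (expI_ne_zero z)]; exact Complex.one_mem_slitPlane

theorem mapsTo_diskExtension (h : IsCircleLift ψ) {w : ℂ} (hw : ‖w‖ ≤ 1) :
    ‖diskExtension ψ w‖ ≤ 1 := by
  rcases eq_or_ne w 0 with rfl | h0
  · simp [diskExtension]
  · obtain ⟨z, hz, rfl⟩ := exists_expI_eq h0 hw
    rw [h.diskExtension_expI, norm_expI, Real.exp_le_one_iff]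
    linarith [h.beurlingAhlfors_im_nonneg hz]

theorem injOn_diskExtension (h : IsCircleLift ψ) :
    InjOn (diskExtension ψ) (Metric.closedBall 0 1) := by
  intro w hw w' hw' he
  rw [mem_closedBall_zero_iff] at hw hw'
  rcases eq_or_ne w 0 with rfl | h0 <;> rcases eq_or_ne w' 0 with rfl | h0'
  · rfl
  · obtain ⟨z, -, rfl⟩ := exists_expI_eq h0' hw'
    rw [h.diskExtension_expI] at he
    exact absurd he.symm (by simp [diskExtension, expI_ne_zero])
  · obtain ⟨z, -, rfl⟩ := exists_expI_eq h0 hw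
    rw [h.diskExtension_expI] at he
    exact absurd he (by simp [diskExtension, expI_ne_zero])
  · obtain ⟨z, hz, rfl⟩ := exists_expI_eq h0 hw
    obtain ⟨z', hz', rfl⟩ := exists_expI_eq h0' hw'
    rw [h.diskExtension_expI, h.diskExtension_expI] at he
    obtain ⟨n, hn⟩ := expI_eq_expI_iff.1 he
    rw [← h.beurlingAhlfors_add_two_pi] at hn
    have := h.injOn_beurlingAhlfors hz (by simpa using hz') hn
    exact expI_eq_expI_iff.2 ⟨n, this⟩

theorem surjOn_diskExtension (h : IsCircleLift ψ) :
    SurjOn (diskExtension ψ) (Metric.closedBall 0 1) (Metric.closedBall 0 1) := by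
  intro w hw
  rw [mem_closedBall_zero_iff] at hw
  rcases eq_or_ne w 0 with rfl | h0
  · exact ⟨0, by simp, by simp [diskExtension]⟩
  · obtain ⟨ζ, hζ, rfl⟩ := exists_expI_eq h0 hw
    obtain ⟨z, hz, rfl⟩ := h.surjOn_beurlingAhlfors hζ
    refine ⟨expI z, ?_, h.diskExtension_expI z⟩
    rw [mem_closedBall_zero_iff, norm_expI, Real.exp_le_one_iff]
    simpa using hz

theorem isHomeomorphicExtension (h : IsCircleLift ψ) (c : ℂ ≃ₗᵢ[ℝ] ℂ)
    {φ : UnitCircle ≃ₜ UnitCircle} (hφ : ∀ θ, (φ (circlePoint θ) : ℂ) = c (expI (ψ θ))) :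
    IsHomeomorphicExtension φ (fun w => c (diskExtension ψ w)) := by
  refine ⟨?_, fun ξ => ?_⟩
  · let F : ClosedDisk → ClosedDisk := fun w => ⟨c (diskExtension ψ w), by
      rw [mem_closedBall_zero_iff, c.norm_map]
      exact h.mapsTo_diskExtension (mem_closedBall_zero_iff.1 w.2)⟩
    have hF : Continuous F := Continuous.subtype_mk
      (c.continuous.comp (h.continuous_diskExtension.comp continuous_subtype_val)) _
    have hbij : Function.Bijective F := by
      constructor
      · intro w w' he
        exact Subtype.ext (h.injOn_diskExtension w.2 w'.2
          (c.injective (congrArg Subtype.val he)))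
      · intro w
        have hw : c.symm w ∈ Metric.closedBall (0 : ℂ) 1 := by
          rw [mem_closedBall_zero_iff, c.symm.norm_map]
          exact mem_closedBall_zero_iff.1 w.2
        obtain ⟨v, hv, hvw⟩ := h.surjOn_diskExtension hw
        exact ⟨⟨v, hv⟩, Subtype.ext (by simp [F, hvw])⟩
    have hF' : Continuous (Equiv.ofBijective F hbij) := hF
    exact ⟨hF'.homeoOfEquivCompactToT2, fun z => rfl⟩
  · obtain ⟨z, hz⟩ := exists_expI_eq (w := ξ) (by
      intro h0; have : ‖(ξ : ℂ)‖ = 1 := by simp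
      simp [h0] at this) (by simp)
    have hn : z.im = 0 := by
      have : ‖(ξ : ℂ)‖ = 1 := by simp
      rw [← hz.2, norm_expI, Real.exp_eq_one_iff] at this
      linarith
    have hzr : z = (z.re : ℂ) := Complex.ext rfl (by simp [hn])
    have hξ : ξ = circlePoint z.re := Subtype.ext (by rw [coe_circlePoint, ← hzr, hz.2])
    rw [hξ, hφ]
    simp only [coe_circlePoint, h.diskExtension_expI, beurlingAhlfors_ofReal]

end IsCircleLift

/-! ### The differential of the extension -/

namespace IsCircleLift

variable {ψ : ℝ → ℝ}

theorem hasFDerivAt_segmentMean (h : IsCircleLift ψ) {z : ℂ} (hz : z.im ≠ 0) :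
    HasFDerivAt (fun z : ℂ => segmentMean ψ z.re z.im)
      (((ψ (z.re + z.im) - ψ z.re) / z.im) • Complex.reCLM +
        ((ψ (z.re + z.im) - segmentMean ψ z.re z.im) / z.im) • Complex.imCLM) z := by
  set P : ℝ → ℝ := fun x => ∫ t in (0 : ℝ)..x, ψ t
  have hPd : ∀ x, HasDerivAt P (ψ x) x := fun x => (h.continuous.integral_hasStrictDerivAt 0 x).hasDerivAt
  have hM : ∀ w : ℂ, w.im ≠ 0 → segmentMean ψ w.re w.im = (P (w.re + w.im) - P w.re) * w.im⁻¹ := by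
    intro w hw
    have h1 := intervalIntegral.smul_integral_comp_add_mul (a := 0) (b := 1) (f := ψ) w.im w.re
    simp only [mul_zero, add_zero, mul_one] at h1
    have h2 : P (w.re + w.im) - P w.re = ∫ t in w.re..w.re + w.im, ψ t :=
      intervalIntegral.integral_interval_sub_left (h.continuous.intervalIntegrable _ _)
        (h.continuous.intervalIntegrable _ _)
    rw [h2, ← h1, smul_eq_mul, mul_comm w.im, mul_inv_cancel_right₀ hw]
    simp only [segmentMean, mul_comm]
  have hre : HasFDerivAt (fun w : ℂ => w.re) Complex.reCLM z := Complex.reCLM.hasFDerivAt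
  have him : HasFDerivAt (fun w : ℂ => w.im) Complex.imCLM z := Complex.imCLM.hasFDerivAt
  have hd := (((hPd (z.re + z.im)).comp_hasFDerivAt z (hre.add him)).sub
    ((hPd z.re).comp_hasFDerivAt z hre)).mul ((hasDerivAt_inv hz).comp_hasFDerivAt z him)
  refine (hd.congr_of_eventuallyEq ?_).congr_fderiv ?_
  · filter_upwards [(isOpen_ne_fun Complex.continuous_im continuous_const).mem_nhds hz] with w hw
    exact hM w hw
  · ext v
    simp [hM z hz]
    field_simp
    ring

theorem exists_hasFDerivAt_segmentMean (h : IsCircleLift ψ) {z : ℂ} (hz : z.im ≠ 0) :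
    ∃ D : ℂ →L[ℝ] ℝ, HasFDerivAt (fun z : ℂ => segmentMean ψ z.re z.im) D z ∧
      ‖D‖ ≤ 2 * (|ψ (z.re + z.im) - ψ z.re| / |z.im|) := by
  refine ⟨_, h.hasFDerivAt_segmentMean hz, ?_⟩
  have hc := h.continuous
  have hle : |ψ (z.re + z.im) - segmentMean ψ z.re z.im| ≤ |ψ (z.re + z.im) - ψ z.re| := by
    have h1 : ψ (z.re + z.im) - segmentMean ψ z.re z.im =
        ∫ t in (0 : ℝ)..1, (ψ (z.re + z.im) - ψ (z.re + t * z.im)) := by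
      rw [intervalIntegral.integral_sub]
      · simp [segmentMean]
      all_goals exact Continuous.intervalIntegrable (by fun_prop) _ _
    rw [h1, ← Real.norm_eq_abs]
    refine (intervalIntegral.norm_integral_le_of_norm_le_const
      (C := |ψ (z.re + z.im) - ψ z.re|) fun t ht => ?_).trans (by simp)
    rw [uIoc_of_le zero_le_one] at ht
    rw [Real.norm_eq_abs]
    rcases le_total 0 z.im with h0 | h0
    · have a1 := h.strictMono.monotone (show z.re ≤ z.re + t * z.im by nlinarith [ht.1])
      have a2 := h.strictMono.monotone (show z.re + t * z.im ≤ z.re + z.im by nlinarith [ht.2])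
      rw [abs_of_nonneg (by linarith), abs_of_nonneg (by linarith)]
      linarith
    · have a1 := h.strictMono.monotone (show z.re + t * z.im ≤ z.re by nlinarith [ht.1])
      have a2 := h.strictMono.monotone (show z.re + z.im ≤ z.re + t * z.im by nlinarith [ht.2])
      rw [abs_of_nonpos (by linarith), abs_of_nonpos (by linarith)]
      linarith
  refine (norm_add_le _ _).trans ?_
  rw [norm_smul, norm_smul, Complex.reCLM_norm, Complex.imCLM_norm, mul_one, mul_one,
    Real.norm_eq_abs, Real.norm_eq_abs, abs_div, abs_div, two_mul]
  exact add_le_add le_rfl (div_le_div_of_nonneg_right hle (abs_nonneg _))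

/-- The differential of the Beurling-Ahlfors extension at `x + i y` is controlled by the difference
quotient of `ψ` over `[x - y, x + y]`. -/
theorem exists_hasFDerivAt_beurlingAhlfors (h : IsCircleLift ψ) {z : ℂ} (hz : 0 < z.im) :
    ∃ D : ℂ →L[ℝ] ℂ, HasFDerivAt (beurlingAhlfors ψ) D z ∧
      ‖D‖ ≤ 6 * ((ψ (z.re + z.im) - ψ (z.re - z.im)) / z.im) := by
  obtain ⟨D₁, hD₁, hn₁⟩ := h.exists_hasFDerivAt_segmentMean hz.ne'
  obtain ⟨D₂', hD₂', hn₂⟩ := h.exists_hasFDerivAt_segmentMean (z := (starRingEnd ℂ) z)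
    (by simpa using hz.ne')
  have hconj : HasFDerivAt (fun w : ℂ => (starRingEnd ℂ) w) Complex.conjCLE.toContinuousLinearMap z :=
    Complex.conjCLE.toContinuousLinearMap.hasFDerivAt
  have hD₂ := hD₂'.comp z hconj
  set D₂ := D₂'.comp Complex.conjCLE.toContinuousLinearMap
  have hn₂' : ‖D₂‖ ≤ ‖D₂'‖ :=
    ContinuousLinearMap.opNorm_le_bound _ (norm_nonneg _) fun v => by
      refine (D₂'.le_opNorm _).trans (le_of_eq ?_)
      simp
  have e1 : HasFDerivAt (beurlingAhlfors ψ)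
      (Complex.ofRealCLM.comp ((1 / 2 : ℝ) • (D₁ + D₂)) +
        Complex.I • Complex.ofRealCLM.comp (D₁ - D₂)) z := by
    have h1 := (Complex.ofRealCLM.hasFDerivAt.comp z ((hD₁.add hD₂).const_smul (1 / 2 : ℝ))).add
      ((Complex.ofRealCLM.hasFDerivAt.comp z (hD₁.sub hD₂)).const_smul Complex.I)
    refine h1.congr_of_eventuallyEq (Eventually.of_forall fun w => ?_)
    apply Complex.ext
    · simp [beurlingAhlfors]; ring
    · simp [beurlingAhlfors]
  refine ⟨_, e1, ?_⟩
  have hω₁ : ‖D₁‖ ≤ 2 * ((ψ (z.re + z.im) - ψ (z.re - z.im)) / z.im) := by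
    refine hn₁.trans ?_
    have a1 := h.strictMono.monotone (show z.re ≤ z.re + z.im by linarith)
    have a2 := h.strictMono.monotone (show z.re - z.im ≤ z.re by linarith)
    rw [abs_of_pos hz, abs_of_nonneg (by linarith)]
    gcongr
  have hω₂ : ‖D₂‖ ≤ 2 * ((ψ (z.re + z.im) - ψ (z.re - z.im)) / z.im) := by
    refine hn₂'.trans (hn₂.trans ?_)
    have a1 := h.strictMono.monotone (show z.re ≤ z.re + z.im by linarith)
    have a2 := h.strictMono.monotone (show z.re - z.im ≤ z.re by linarith)
    rw [Complex.conj_re, Complex.conj_im, abs_neg, abs_of_pos hz, ← sub_eq_add_neg,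
      abs_of_nonpos (by linarith)]
    gcongr
    linarith
  have hof : ∀ D : ℂ →L[ℝ] ℝ, ‖Complex.ofRealCLM.comp D‖ ≤ ‖D‖ := fun D =>
    (ContinuousLinearMap.opNorm_comp_le _ _).trans (by rw [Complex.ofRealCLM_norm, one_mul])
  calc _ ≤ ‖(1 / 2 : ℝ) • (D₁ + D₂)‖ + ‖D₁ - D₂‖ := by
        refine (norm_add_le _ _).trans (add_le_add (hof _) ?_)
        rw [norm_smul, Complex.norm_I, one_mul]
        exact hof _
    _ ≤ 1 / 2 * (‖D₁‖ + ‖D₂‖) + (‖D₁‖ + ‖D₂‖) := by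
        rw [norm_smul, Real.norm_of_nonneg (by norm_num)]
        gcongr
        · exact norm_add_le _ _
        · exact norm_sub_le _ _
    _ ≤ _ := by linarith

theorem exists_hasFDerivAt_diskExtension (h : IsCircleLift ψ) {z : ℂ} (hz : 0 < z.im) :
    ∃ D : ℂ →L[ℝ] ℂ, HasFDerivAt (diskExtension ψ) D (expI z) ∧
      ‖D‖ ≤ Real.exp (4 * Real.pi) *
        (6 * ((ψ (z.re + z.im) - ψ (z.re - z.im)) / z.im)) := by
  obtain ⟨D, hD, hn⟩ := h.exists_hasFDerivAt_beurlingAhlfors hz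
  have hexp : ∀ ζ, HasDerivAt expI (expI ζ * Complex.I) ζ := fun ζ => by
    have : HasDerivAt (fun ζ : ℂ => Complex.I * ζ) Complex.I ζ := by
      simpa using (hasDerivAt_id ζ).const_mul Complex.I
    exact this.cexp
  have hL : HasDerivAt (fun w => z + -Complex.I * Complex.log (w / expI z))
      (-Complex.I * (1 / expI z)) (expI z) := by
    have h1 : HasDerivAt (fun w : ℂ => w / expI z) (1 / expI z) (expI z) :=
      (hasDerivAt_id _).div_const _
    have h2 := h1.clog (by rw [div_self (expI_ne_zero z)]; exact Complex.one_mem_slitPlane)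
    rw [div_self (expI_ne_zero z), div_one] at h2
    exact (h2.const_mul (-Complex.I)).const_add z
  have hL0 : z + -Complex.I * Complex.log (expI z / expI z) = z := by
    rw [div_self (expI_ne_zero z), Complex.log_one, mul_zero, add_zero]
  have hc := ((hexp _).hasFDerivAt.restrictScalars ℝ).comp (expI z)
    (HasFDerivAt.comp (expI z) (by rw [hL0]; exact hD) (hL.hasFDerivAt.restrictScalars ℝ))
  refine ⟨_, hc.congr_of_eventuallyEq (h.diskExtension_eventuallyEq z), ?_⟩
  have hω : 0 ≤ (ψ (z.re + z.im) - ψ (z.re - z.im)) / z.im :=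
    div_nonneg (sub_nonneg.2 (h.strictMono.monotone (by linarith))) hz.le
  refine ContinuousLinearMap.opNorm_le_bound _ (by positivity) fun v => ?_
  have hratio : ‖expI (beurlingAhlfors ψ z)‖ ≤ Real.exp (4 * Real.pi) * ‖expI z‖ := by
    rw [← h.diskExtension_expI]; exact h.norm_diskExtension_le _
  have hpos : 0 < ‖expI z‖ := norm_pos_iff.2 (expI_ne_zero z)
  have hDv : ‖D (v * (-Complex.I * (1 / expI z)))‖ ≤
      6 * ((ψ (z.re + z.im) - ψ (z.re - z.im)) / z.im) * (‖v‖ / ‖expI z‖) := by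
    refine (D.le_of_opNorm_le hn _).trans (le_of_eq ?_)
    simp [div_eq_mul_inv]
  simp only [hL0, Function.comp_apply, ContinuousLinearMap.comp_apply,
    ContinuousLinearMap.coe_restrictScalars', ContinuousLinearMap.toSpanSingleton_apply,
    smul_eq_mul, norm_mul, Complex.norm_I, mul_one]
  calc _ ≤ 6 * ((ψ (z.re + z.im) - ψ (z.re - z.im)) / z.im) * (‖v‖ / ‖expI z‖) *
        (Real.exp (4 * Real.pi) * ‖expI z‖) := by gcongr
    _ = _ := by field_simp

end IsCircleLift

/-! ### Weak differentials and removable points -/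

/-- A continuous map that is differentiable off the origin and has an integrable differential has no
singular part at the origin: this is the divergence theorem, which tolerates countably many points at
which the vector field is merely continuous. -/
theorem hasWeakDifferential_fderiv {h : ℂ → ℂ} (hc : Continuous h)
    (hd : ∀ w ∈ Metric.ball (0 : ℂ) 1, w ≠ 0 → DifferentiableAt ℝ h w)
    (hi : IntegrableOn (fderiv ℝ h) (Metric.ball 0 1)) :
    HasWeakDifferential openDisk h (fderiv ℝ h) := by
  refine ⟨(hc.locallyIntegrable).locallyIntegrableOn _, hi.locallyIntegrableOn, fun η v => ?_⟩
  change ∫ x in Metric.ball (0 : ℂ) 1, (fderiv ℝ η x v) • h x =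
    -∫ x in Metric.ball (0 : ℂ) 1, η x • fderiv ℝ h x v
  have hηs : tsupport η ⊆ Metric.ball (0 : ℂ) 1 := η.tsupport_subset
  have hη1 : ContDiff ℝ 1 η := η.contDiff.of_le (by exact_mod_cast le_top)
  have hηc : Continuous η := hη1.continuous
  have hη'c : Continuous (fderiv ℝ η) := hη1.continuous_fderiv (by norm_num)
  have hη0 : ∀ x ∉ Metric.ball (0 : ℂ) 1, η x = 0 := fun x hx =>
    image_eq_zero_of_notMem_tsupport fun h' => hx (hηs h')
  have hη'0 : ∀ x ∉ Metric.ball (0 : ℂ) 1, fderiv ℝ η x = 0 := fun x hx =>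
    image_eq_zero_of_notMem_tsupport fun h' => hx (hηs (tsupport_fderiv_subset ℝ h'))
  set W : ℂ → ℂ := fun x => η x • h x with hW
  set D : ℂ → (ℂ →L[ℝ] ℂ) := fun x => η x • fderiv ℝ h x + (fderiv ℝ η x).smulRight (h x) with hD
  have hWd : ∀ x ≠ 0, HasFDerivAt W (D x) x := by
    intro x hx0
    by_cases hx : x ∈ tsupport η
    · exact ((hη1.differentiable (by norm_num)) x).hasFDerivAt.smul
        (hd x (hηs hx) hx0).hasFDerivAt
    · have h1 : η =ᶠ[𝓝 x] 0 := notMem_tsupport_iff_eventuallyEq.1 hx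
      have h2 : D x = 0 := by
        simp only [hD, h1.fderiv_eq, h1.eq_of_nhds]
        simp
      rw [h2]
      refine (hasFDerivAt_const (0 : ℂ) x).congr_of_eventuallyEq ?_
      filter_upwards [h1] with y hy
      simp [hW, hy]
  have hD0 : ∀ x ∉ Metric.ball (0 : ℂ) 1, D x v = 0 := fun x hx => by
    simp [hD, hη0 x hx, hη'0 x hx]
  obtain ⟨B, hB⟩ := η.hasCompactSupport.exists_bound_of_continuous hηc
  have hi1 : IntegrableOn (fun x => η x • fderiv ℝ h x v) (Metric.ball 0 1) :=
    (hi.apply_continuousLinearMap v).bdd_smul B hηc.aestronglyMeasurable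
      (Eventually.of_forall hB)
  have hi2 : IntegrableOn (fun x => (fderiv ℝ η x v) • h x) (Metric.ball 0 1) :=
    (Continuous.continuousOn (by fun_prop)).integrableOn_compact
      (isCompact_closedBall (0 : ℂ) 1) |>.mono_set Metric.ball_subset_closedBall
  have hDv : ∀ x, D x v = η x • fderiv ℝ h x v + (fderiv ℝ η x v) • h x := fun x => by
    simp [hD]
  have hiD : Integrable fun x => D x v := by
    rw [← integrableOn_iff_integrable_of_support_subset (s := Metric.ball (0 : ℂ) 1)]
    · simp only [hDv]; exact hi1.add hi2
    · exact fun x hx => by_contra fun h' => hx (hD0 x h')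
  -- the divergence theorem on a square containing the disk
  have hmain : ∫ x, D x v = 0 := by
    set e : (ℝ × ℝ) ≃L[ℝ] ℂ := Complex.equivRealProdCLM.symm with he
    have hemp : MeasurePreserving Complex.measurableEquivRealProd.symm :=
      Complex.volume_preserving_equiv_real_prod.symm
    have hre : ∀ p : ℝ × ℝ, (e p).re = p.1 := fun p => rfl
    have him : ∀ p : ℝ × ℝ, (e p).im = p.2 := fun p => rfl
    have hWc : Continuous W := by fun_prop
    have hW0 : ∀ p : ℝ × ℝ, (1 ≤ |p.1| ∨ 1 ≤ |p.2|) → W (e p) = 0 := by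
      intro p hp
      have : e p ∉ Metric.ball (0 : ℂ) 1 := fun hm => by
        rw [mem_ball_zero_iff] at hm
        have h1 := Complex.abs_re_le_norm (e p)
        have h2 := Complex.abs_im_le_norm (e p)
        rw [hre] at h1; rw [him] at h2
        rcases hp with hp | hp <;> linarith
      simp [hW, hη0 _ this]
    have hDi : Integrable fun p : ℝ × ℝ => D (e p) v :=
      (hemp.integrable_comp_emb Complex.measurableEquivRealProd.symm.measurableEmbedding).2 hiD
    have hvd : ∀ p : ℝ × ℝ, (v.re • (D (e p)).comp e.toContinuousLinearMap) (1, 0) +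
        (v.im • (D (e p)).comp e.toContinuousLinearMap) (0, 1) = D (e p) v := by
      intro p
      have hv : v = v.re • e (1, 0) + v.im • e (0, 1) := by
        apply Complex.ext <;> simp [he]
      conv_rhs => rw [hv, map_add, map_smul, map_smul]
      rfl
    have hdiv := integral_divergence_prod_Icc_of_hasFDerivAt_off_countable_of_le
      (fun p => v.re • W (e p)) (fun p => v.im • W (e p))
      (fun p => v.re • (D (e p)).comp e.toContinuousLinearMap)
      (fun p => v.im • (D (e p)).comp e.toContinuousLinearMap)
      (-2, -2) (2, 2) (by constructor <;> norm_num) {0} (countable_singleton _)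
      (by fun_prop) (by fun_prop)
      (fun p hp => ((hWd (e p) (by simpa using hp.2)).comp p e.hasFDerivAt).const_smul v.re)
      (fun p hp => ((hWd (e p) (by simpa using hp.2)).comp p e.hasFDerivAt).const_smul v.im)
      (by simp only [hvd]; exact hDi.integrableOn)
    simp only [hvd] at hdiv
    rw [← hemp.integral_comp Complex.measurableEquivRealProd.symm.measurableEmbedding]
    change ∫ p, D (e p) v = 0
    rw [← setIntegral_eq_integral_of_forall_compl_eq_zero (s := Icc ((-2 : ℝ), (-2 : ℝ)) (2, 2)),
      hdiv]
    · simp [hW0]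
    · intro p hp
      refine hD0 _ fun hm => hp ?_
      rw [mem_ball_zero_iff] at hm
      have h1 := abs_le.1 ((Complex.abs_re_le_norm (e p)).trans hm.le)
      have h2 := abs_le.1 ((Complex.abs_im_le_norm (e p)).trans hm.le)
      rw [hre] at h1; rw [him] at h2
      exact ⟨⟨by linarith [h1.1], by linarith [h2.1]⟩, ⟨by linarith [h1.2], by linarith [h2.2]⟩⟩
  rw [← setIntegral_eq_integral_of_forall_compl_eq_zero (s := Metric.ball (0 : ℂ) 1) hD0] at hmain
  simp only [hDv] at hmain
  rw [integral_add hi1 hi2] at hmain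
  exact eq_neg_of_add_eq_zero_right hmain

/-! ### The energy of the extension -/

theorem norm_expI_sub_expI_le (s t : ℝ) : ‖expI s - expI (s + t : ℝ)‖ ≤ |t| := by
  rw [norm_expI_sub_expI]
  have := Real.abs_sin_le_abs (x := t / 2)
  rw [abs_div, abs_two] at this
  linarith

namespace IsCircleLift

variable {ψ : ℝ → ℝ}

theorem exists_modulus (h : IsCircleLift ψ) :
    ∃ δ > 0, δ ≤ 1 ∧ ∀ s t, |s - t| ≤ δ → |ψ s - ψ t| ≤ Real.pi := by
  obtain ⟨δ, hδ, hu⟩ := Metric.uniformContinuousOn_iff.1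
    ((isCompact_Icc (a := (-1 : ℝ)) (b := 2 * Real.pi + 1)).uniformContinuousOn_of_continuous
      h.continuous.continuousOn) Real.pi Real.pi_pos
  refine ⟨min (δ / 2) 1, by positivity, min_le_right _ _, fun s t hst => ?_⟩
  obtain ⟨n, hn, -⟩ := existsUnique_add_zsmul_mem_Ico Real.two_pi_pos s 0
  simp only [zsmul_eq_mul, mul_comm (n : ℝ), zero_add] at hn
  have h1 : |s - t| ≤ 1 := hst.trans (min_le_right _ _)
  have h2 : |s - t| ≤ δ / 2 := hst.trans (min_le_left _ _)
  have h3 := abs_le.1 h1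
  have h4 := hu (s + 2 * Real.pi * n) ⟨by linarith [hn.1], by linarith [hn.2]⟩
    (t + 2 * Real.pi * n) ⟨by linarith [hn.1, h3.2], by linarith [hn.2, h3.1]⟩
    (by rw [Real.dist_eq, add_sub_add_right_eq_sub]; linarith)
  rw [Real.dist_eq, h.map_add_int_mul, h.map_add_int_mul, add_sub_add_right_eq_sub] at h4
  exact h4.le

theorem differentiableAt_and_norm_fderiv_le (h : IsCircleLift ψ) (c : ℂ ≃ₗᵢ[ℝ] ℂ) {z : ℂ} (hz : 0 < z.im) :
    DifferentiableAt ℝ (fun w => c (diskExtension ψ w)) (expI z) ∧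
      ‖fderiv ℝ (fun w => c (diskExtension ψ w)) (expI z)‖ ≤ Real.exp (4 * Real.pi) *
        (6 * ((ψ (z.re + z.im) - ψ (z.re - z.im)) / z.im)) := by
  obtain ⟨D, hD, hn⟩ := h.exists_hasFDerivAt_diskExtension hz
  have hc : HasFDerivAt (fun w => c (diskExtension ψ w))
      ((c.toContinuousLinearEquiv : ℂ →L[ℝ] ℂ).comp D) (expI z) :=
    (c.toContinuousLinearEquiv : ℂ →L[ℝ] ℂ).hasFDerivAt.comp (expI z) hD
  refine ⟨hc.differentiableAt, ?_⟩
  rw [hc.fderiv]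
  refine le_trans (ContinuousLinearMap.opNorm_le_bound _ (norm_nonneg D) fun v => ?_) hn
  simpa using D.le_opNorm v

/-- For small `y`, the difference quotient of the lift `ψ` is controlled by that of the circle map: nearby
values of `ψ` differ by at most `π`, where arcs and chords are comparable. For large `y` it is
bounded. -/
theorem lintegral_fderiv_lt_top (h : IsCircleLift ψ) (c : ℂ ≃ₗᵢ[ℝ] ℂ) {Φ : ℝ → ℝ}
    (hN : IsNFunction Φ) (hΦ : Continuous Φ) (hD : IsDoubling Φ) {φ : UnitCircle ≃ₜ UnitCircle}
    (hφ : ∀ θ, (φ (circlePoint θ) : ℂ) = c (expI (ψ θ)))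
    (hdoug : DouglasCondition Φ fun ξ => (φ ξ : ℂ)) :
    ∫⁻ w in Metric.ball (0 : ℂ) 1, ENNReal.ofReal
      (Φ ‖fderiv ℝ (fun w => c (diskExtension ψ w)) w‖) < ∞ := by
  obtain ⟨δ, hδ, hδ1, hmod⟩ := h.exists_modulus
  set K : ℝ := Real.exp (4 * Real.pi) * 6
  have hK0 : 0 < K := by positivity
  obtain ⟨C, hC, hdoub⟩ := hD.exists_map_mul_le hN (a := K * 4) (by positivity)
  set q : ℝ → ℝ → ℝ := fun s τ =>
    ‖(expI (ψ s) - expI (ψ (s + τ))) / (expI s - expI (s + τ : ℝ))‖ with hq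
  have hq0 : ∀ s τ, 0 ≤ q s τ := fun s τ => norm_nonneg _
  set Q : ℝ → ℝ → ℝ≥0∞ := fun s τ => ENNReal.ofReal (Φ (q s τ)) with hQ
  have hQm : Measurable fun p : ℝ × ℝ => Q p.1 p.2 := by
    have hE := continuous_expI
    have hψ := h.continuous
    refine (hΦ.measurable.comp (Measurable.norm (Measurable.div ?_ ?_))).ennreal_ofReal
    · exact Continuous.measurable (by fun_prop)
    · exact Continuous.measurable (by fun_prop)
  have hQper : ∀ τ, Function.Periodic (fun s => Q s τ) (2 * Real.pi) := fun τ s => by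
    have e1 : s + 2 * Real.pi + τ = s + τ + 2 * Real.pi := by ring
    have e2 : ∀ t : ℝ, expI (ψ t + 2 * Real.pi : ℝ) = expI (ψ t) := fun t => by
      rw [Complex.ofReal_add, expI_add_two_pi]
    have e3 : ∀ t : ℝ, expI (t + 2 * Real.pi : ℝ) = expI t := fun t => by
      rw [Complex.ofReal_add, expI_add_two_pi]
    simp only [hQ, hq, e1, h.map_add_two_pi, e2, e3]
  have hdouglas : ∫⁻ s in Ioc 0 (2 * Real.pi), ∫⁻ τ in Ioc (-Real.pi) Real.pi, Q s τ < ∞ := by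
    have hKm : Measurable (Function.uncurry fun ξ η : UnitCircle =>
        ENNReal.ofReal (Φ ‖((φ ξ : ℂ) - φ η) / ((ξ : ℂ) - (η : ℂ))‖)) := by
      have := φ.continuous
      refine (hΦ.measurable.comp (Measurable.norm (Measurable.div ?_ ?_))).ennreal_ofReal
      · exact Continuous.measurable (by fun_prop)
      · exact Continuous.measurable (by fun_prop)
    unfold DouglasCondition at hdoug
    rw [lintegral_arcLength_arcLength hKm] at hdoug
    refine lt_of_le_of_lt (le_of_eq ?_) hdoug
    refine lintegral_congr fun s => lintegral_congr fun τ => ?_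
    simp only [hQ, hq]
    rw [hφ, hφ, ← map_sub, norm_div, norm_div, c.norm_map, coe_circlePoint, coe_circlePoint]
  set B : ℝ := K * (2 + 4 * Real.pi / δ)
  have hpt : ∀ x y : ℝ, y ∈ Ioi (0 : ℝ) → ENNReal.ofReal
      (Φ ‖fderiv ℝ (fun w => c (diskExtension ψ w)) (expI (x + y * Complex.I))‖) ≤
      (Iic (δ / 2)).indicator (fun y => ENNReal.ofReal C * Q (x + -y) (y * 2)) y +
        ENNReal.ofReal (Φ B) := by
    intro x y hy
    have hy : 0 < y := hy
    have hn := (h.differentiableAt_and_norm_fderiv_le c (z := x + y * Complex.I) (by simpa using hy)).2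
    have e1 : ((x : ℂ) + y * Complex.I).re = x := by simp
    have e2 : ((x : ℂ) + y * Complex.I).im = y := by simp
    rw [e1, e2, ← mul_assoc] at hn
    by_cases hyδ : y ≤ δ / 2
    · rw [indicator_of_mem (show y ∈ Iic (δ / 2) from hyδ)]
      refine le_trans ?_ le_self_add
      simp only [hQ]
      rw [← ENNReal.ofReal_mul hC]
      refine ENNReal.ofReal_le_ofReal ?_
      refine le_trans (hN.monotoneOn (mem_Ici.2 (norm_nonneg _))
        (mem_Ici.2 (mul_nonneg (by positivity) (hq0 _ _))) (hn.trans ?_)) (hdoub _ (hq0 _ _))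
      rw [mul_assoc K 4]
      refine mul_le_mul_of_nonneg_left ?_ hK0.le
      have e3 : x + -y + y * 2 = x + y := by ring
      simp only [hq]
      have hlow : |ψ (x + y) - ψ (x - y)| ≤ 2 * ‖expI (ψ (x + -y)) - expI (ψ (x + y))‖ := by
        have h1 : |ψ (x + y) - ψ (x - y)| ≤ Real.pi :=
          hmod _ _ (by rw [show x + y - (x - y) = 2 * y by ring, abs_of_pos (by linarith)]
                       linarith)
        have := abs_le_two_mul_norm_expI_sub_expI (ψ (x - y)) h1
        rwa [add_sub_cancel, sub_eq_add_neg x y] at this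
      have hup : ‖expI (x + -y : ℝ) - expI (x + y : ℝ)‖ ≤ y * 2 := by
        have := norm_expI_sub_expI_le (x + -y) (y * 2)
        rwa [e3, abs_of_pos (by linarith)] at this
      have hpos : 0 < ‖expI (x + -y : ℝ) - expI (x + y : ℝ)‖ := by
        have := abs_le_two_mul_norm_expI_sub_expI (x + -y) (t := y * 2)
          (by rw [abs_of_pos (by linarith)]; linarith [Real.pi_gt_three])
        rw [e3, abs_of_pos (by linarith)] at this
        linarith
      rw [e3, norm_div, div_le_iff₀ hy, mul_assoc, div_mul_eq_mul_div, ← mul_div_assoc,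
        le_div_iff₀ hpos]
      have h5 : 0 ≤ ψ (x + y) - ψ (x - y) :=
        sub_nonneg.2 (h.strictMono.monotone (by linarith))
      rw [abs_of_nonneg h5] at hlow
      calc _ ≤ (ψ (x + y) - ψ (x - y)) * (y * 2) := by gcongr
        _ ≤ 2 * ‖expI (ψ (x + -y)) - expI (ψ (x + y))‖ * (y * 2) := by gcongr
        _ = _ := by ring
    · push Not at hyδ
      refine le_trans (ENNReal.ofReal_le_ofReal ?_) le_add_self
      refine hN.monotoneOn (mem_Ici.2 (norm_nonneg _)) (mem_Ici.2 (by positivity)) (hn.trans ?_)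
      refine mul_le_mul_of_nonneg_left ?_ hK0.le
      have h1 := (abs_le.1 (h.abs_sub_sub_le (x + y) (x - y))).2
      rw [div_le_iff₀ hy]
      have h2 : 2 * Real.pi ≤ 4 * Real.pi / δ * y := by
        rw [div_mul_eq_mul_div, le_div_iff₀ hδ]
        nlinarith [Real.pi_pos]
      linarith
  have hm : Measurable fun w => ENNReal.ofReal
      (Φ ‖fderiv ℝ (fun w => c (diskExtension ψ w)) w‖) :=
    (hΦ.measurable.comp (measurable_fderiv ℝ _).norm).ennreal_ofReal
  set J : ℝ → ℝ≥0∞ := fun τ => ∫⁻ x in Ioc 0 (2 * Real.pi), Q x τ with hJ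
  have hconst : ∫⁻ y in Ioi (0 : ℝ), ENNReal.ofReal (Real.exp (-(2 * y))) *
      ∫⁻ x in Ioc 0 (2 * Real.pi), ENNReal.ofReal (Φ B) < ∞ := by
    rw [← lintegral_openDisk (g := fun _ => ENNReal.ofReal (Φ B)) measurable_const,
      setLIntegral_const]
    exact ENNReal.mul_lt_top ENNReal.ofReal_lt_top measure_ball_lt_top
  have hind : ∀ y : ℝ, Measurable fun x : ℝ =>
      (Iic (δ / 2)).indicator (fun y => ENNReal.ofReal C * Q (x + -y) (y * 2)) y := by
    intro y
    by_cases hy : y ∈ Iic (δ / 2)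
    · simp only [indicator_of_mem hy]
      exact (hQm.comp ((measurable_id.add_const (-y)).prodMk measurable_const)).const_mul _
    · simp only [indicator_of_notMem hy]
      exact measurable_const
  have hJle : ∫⁻ τ in Ioc 0 δ, J τ < ∞ := by
    refine lt_of_le_of_lt (lintegral_mono_set (Ioc_subset_Ioc ?_ ?_)) (?_ :
      ∫⁻ τ in Ioc (-Real.pi) Real.pi, J τ < ∞)
    · linarith [Real.pi_pos]
    · linarith [Real.pi_gt_three]
    · simp only [hJ]
      rwa [← lintegral_lintegral_swap (f := fun s τ => Q s τ) hQm.aemeasurable]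
  rw [lintegral_openDisk hm]
  calc _ ≤ ∫⁻ y in Ioi (0 : ℝ), ((Iic (δ / 2)).indicator
        (fun y => ENNReal.ofReal C * J (y * 2)) y + ENNReal.ofReal (Real.exp (-(2 * y))) *
          ∫⁻ x in Ioc 0 (2 * Real.pi), ENNReal.ofReal (Φ B)) := by
        refine setLIntegral_mono' measurableSet_Ioi fun y hy => ?_
        refine (mul_le_mul_right (lintegral_mono fun x => hpt x y hy) _).trans ?_
        rw [lintegral_add_left (hind y), mul_add]
        refine add_le_add ?_ le_rfl
        have h1 : ENNReal.ofReal (Real.exp (-(2 * y))) ≤ 1 := by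
          rw [← ENNReal.ofReal_one]
          refine ENNReal.ofReal_le_ofReal (Real.exp_le_one_iff.2 ?_)
          have : 0 < y := hy
          linarith
        refine (mul_le_of_le_one_left zero_le h1).trans ?_
        by_cases hyδ : y ∈ Iic (δ / 2)
        · simp only [indicator_of_mem hyδ]
          rw [lintegral_const_mul' _ _ ENNReal.ofReal_ne_top,
            lintegral_period_add_right (hQper (y * 2)) (-y)]
        · simp only [indicator_of_notMem hyδ, lintegral_zero, le_refl]
    _ = (∫⁻ y in Ioc 0 (δ / 2), ENNReal.ofReal C * J (y * 2)) +
        ∫⁻ y in Ioi (0 : ℝ), ENNReal.ofReal (Real.exp (-(2 * y))) *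
          ∫⁻ x in Ioc 0 (2 * Real.pi), ENNReal.ofReal (Φ B) := by
        rw [lintegral_add_right, lintegral_indicator measurableSet_Iic,
          Measure.restrict_restrict measurableSet_Iic, inter_comm, Ioi_inter_Iic]
        refine Measurable.mul_const ?_ _
        fun_prop
    _ < ∞ := by
        refine ENNReal.add_lt_top.2 ⟨?_, hconst⟩
        rw [lintegral_const_mul' _ _ ENNReal.ofReal_ne_top, lintegral_Ioc_mul_right two_pos,
          div_mul_cancel₀ _ two_ne_zero]
        exact ENNReal.mul_lt_top ENNReal.ofReal_lt_top
          (ENNReal.mul_lt_top ENNReal.ofReal_lt_top hJle)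

theorem memOrliczSobolev (h : IsCircleLift ψ) (c : ℂ ≃ₗᵢ[ℝ] ℂ) {Φ : ℝ → ℝ}
    (hN : IsNFunction Φ) (hΦ : Continuous Φ) (hD : IsDoubling Φ) {φ : UnitCircle ≃ₜ UnitCircle}
    (hφ : ∀ θ, (φ (circlePoint θ) : ℂ) = c (expI (ψ θ)))
    (hdoug : DouglasCondition Φ fun ξ => (φ ξ : ℂ)) :
    MemOrliczSobolev Φ openDisk fun w => c (diskExtension ψ w) := by
  have hfin := h.lintegral_fderiv_lt_top c hN hΦ hD hφ hdoug
  set H : ℂ → ℂ := fun w => c (diskExtension ψ w)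
  have hc : Continuous H := c.continuous.comp h.continuous_diskExtension
  have hint : IntegrableOn (fderiv ℝ H) (Metric.ball 0 1) := by
    -- `Φ` grows faster than linearly
    obtain ⟨T, hT⟩ := eventually_atTop.1 (hN.tendsto_atTop.eventually_ge_atTop 1)
    have hlin : ∀ t, 0 ≤ t → t ≤ Φ t + |T| := fun t ht => by
      rcases ht.eq_or_lt with rfl | ht0
      · have := hN.nonneg 0 le_rfl; positivity
      rcases le_total T t with h' | h'
      · have := hT t h'
        rw [one_le_div ht0] at this
        linarith [abs_nonneg T]
      · linarith [le_abs_self T, hN.nonneg t ht]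
    refine ⟨(measurable_fderiv ℝ H).aestronglyMeasurable, ?_⟩
    rw [hasFiniteIntegral_iff_norm]
    calc ∫⁻ w in Metric.ball (0 : ℂ) 1, ENNReal.ofReal ‖fderiv ℝ H w‖
        ≤ ∫⁻ w in Metric.ball (0 : ℂ) 1,
          (ENNReal.ofReal (Φ ‖fderiv ℝ H w‖) + ENNReal.ofReal |T|) :=
          lintegral_mono fun w => (ENNReal.ofReal_le_ofReal (hlin _ (norm_nonneg _))).trans
            ENNReal.ofReal_add_le
      _ < ∞ := by
          rw [lintegral_add_right _ measurable_const, setLIntegral_const]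
          exact ENNReal.add_lt_top.2 ⟨hfin,
            ENNReal.mul_lt_top ENNReal.ofReal_lt_top measure_ball_lt_top⟩
  refine ⟨?_, fderiv ℝ H, hasWeakDifferential_fderiv hc (fun w hw hw0 => ?_) hint, hint, hfin⟩
  · exact (hc.continuousOn.integrableOn_compact (isCompact_closedBall (0 : ℂ) 1)).mono_set
      Metric.ball_subset_closedBall
  · rw [mem_ball_zero_iff] at hw
    obtain ⟨z, hz, rfl⟩ := exists_expI_eq hw0 hw.le
    rw [norm_expI, Real.exp_lt_one_iff] at hw
    exact (h.differentiableAt_and_norm_fderiv_le c (by linarith)).1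

end IsCircleLift

/-! ### The even extension of a Young function -/

theorem IsNFunction.comp_abs {Φ : ℝ → ℝ} (hN : IsNFunction Φ) : IsNFunction fun t => Φ |t| where
  nonneg t _ := hN.nonneg _ (abs_nonneg t)
  continuousOn := hN.continuousOn.congr fun t ht => by simp only [abs_of_nonneg (mem_Ici.1 ht)]
  convexOn := hN.convexOn.congr fun t ht => by simp only [abs_of_nonneg (mem_Ici.1 ht)]
  monotoneOn := hN.monotoneOn.congr fun t ht => by simp only [abs_of_nonneg (mem_Ici.1 ht)]
  map_zero := by simp [hN.map_zero]
  tendsto_zero := hN.tendsto_zero.congr' <| by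
    filter_upwards [self_mem_nhdsWithin] with t ht
    rw [abs_of_pos ht]
  tendsto_atTop := hN.tendsto_atTop.congr' <| by
    filter_upwards [eventually_gt_atTop 0] with t ht
    rw [abs_of_pos ht]

theorem IsNFunction.continuous_comp_abs {Φ : ℝ → ℝ} (hN : IsNFunction Φ) :
    Continuous fun t => Φ |t| :=
  hN.continuousOn.comp_continuous continuous_abs fun t => abs_nonneg t

theorem IsDoubling.comp_abs {Φ : ℝ → ℝ} (hD : IsDoubling Φ) : IsDoubling fun t => Φ |t| := by
  obtain ⟨C, hC, h⟩ := hD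
  refine ⟨C, hC, fun t ht => ?_⟩
  simp only [abs_mul, abs_two]
  exact h _ (abs_nonneg t)

theorem AIncFrom.comp_abs {Φ : ℝ → ℝ} {p t₀ : ℝ} (hA : AIncFrom Φ p t₀) :
    AIncFrom (fun t => Φ |t|) p t₀ := by
  obtain ⟨C, hC, h⟩ := hA
  refine ⟨C, hC, fun s t hs hts hst => ?_⟩
  simp only [abs_of_pos hs, abs_of_pos (hs.trans_le hst)]
  exact h s t hs hts hst

theorem douglasCondition_comp_abs {Φ : ℝ → ℝ} {φ : UnitCircle → ℂ} :
    DouglasCondition (fun t => Φ |t|) φ ↔ DouglasCondition Φ φ := by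
  simp only [DouglasCondition, abs_norm]

theorem memOrliczSobolev_comp_abs {Φ : ℝ → ℝ} {Ω : TopologicalSpace.Opens ℂ} {f : ℂ → ℂ} :
    MemOrliczSobolev (fun t => Φ |t|) Ω f ↔ MemOrliczSobolev Φ Ω f := by
  simp only [MemOrliczSobolev, abs_norm]

theorem IsHomeomorphicExtension.continuousOn {φ : UnitCircle ≃ₜ UnitCircle} {h : ℂ → ℂ}
    (hh : IsHomeomorphicExtension φ h) : ContinuousOn h (Metric.closedBall 0 1) := by
  obtain ⟨⟨H, hH⟩, -⟩ := hh
  rw [continuousOn_iff_continuous_domRestrict]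
  exact (continuous_subtype_val.comp H.continuous).congr fun z => (hH z).symm

end OrliczExtension

end

theorem corollary1p4 (φ : OrliczExtension.UnitCircle ≃ₜ OrliczExtension.UnitCircle)
    (Φ : ℝ → ℝ) (p t₀ : ℝ) (hp : 1 < p) (ht₀ : 0 ≤ t₀)
    (hN : OrliczExtension.IsNFunction Φ) (hD : OrliczExtension.IsDoubling Φ)
    (hA : OrliczExtension.AIncFrom Φ p t₀) :
    OrliczExtension.DouglasCondition Φ (fun ξ => (φ ξ : ℂ)) ↔
      ∃ h : ℂ → ℂ, OrliczExtension.IsHomeomorphicExtension φ h ∧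
        OrliczExtension.MemOrliczSobolev Φ OrliczExtension.openDisk h := by
  open OrliczExtension in
  rw [← douglasCondition_comp_abs]
  constructor
  · intro hdoug
    obtain ⟨c, ψ, h1, h2, h3, hφ⟩ := exists_strictMono_lift φ
    have hψ : IsCircleLift ψ := ⟨h1, h2, h3⟩
    exact ⟨_, hψ.isHomeomorphicExtension c hφ, memOrliczSobolev_comp_abs.1
      (hψ.memOrliczSobolev c hN.comp_abs hN.continuous_comp_abs hD.comp_abs hφ hdoug)⟩
  · rintro ⟨h, hh, hm⟩
    exact (memOrliczSobolev_comp_abs.2 hm).douglasCondition hp ht₀ hN.comp_abs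
      hN.continuous_comp_abs hD.comp_abs hA.comp_abs hh.continuousOn hh.2
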